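/- **Definitions.** Let $n\ge 2$. A *closed cubical complex of dimension $n$* is given by its face lattice $L$: a lattice with least element $\bot$ (the empty face) and greatest element $\top\neq\bot$ (an improper element added above all faces), such that every element other than $\top$ lies below a coatom (a *facet*), for every facet $F$ the interval $[\bot,F]$ is isomorphic to the face lattice of the $n$-dimensional hypercube, and every $(n-1)$-face lies in exactly two facets (a $k$-face being an element $x$ such that $[\bot,x]$ is isomorphic to the face lattice of the $k$-dimensional hypercube). $L$ may be infinite. The complex is *strongly connected* if any two facets are joined by a finite sequence of facets in which consecutive ones have a common face of codimension one. The star of a vertex $v$ is *strongly connected* if any two facets containing $v$ are joined by such a sequence in which all the facets, and the common faces of codimension one, contain $v$. The *realization* $|\mathcal K|$ is the geometric realization, with the weak topology, of the simplicial complex of finite chains of non-empty proper faces (the barycentric subdivision). The *cubical lattice* $Z^n$ is the tessellation of $\mathbb R^n$ by the unit cubes with integral vertices. Its symmetry group is the group of maps $x\mapsto (\varepsilon_i x_{\sigma(i)}+t_i)_i$ of $\mathbb R^n$, with $\varepsilon_i=\pm1$, $\sigma$ a permutation of $\{1,\dots,n\}$ and $t\in\mathbb Z^n$, i.e. the semidirect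 product of the Coxeter group $B_n$ and the group of integral translations. For a subgroup $\Gamma$ of it, the faces of $Z^n/\Gamma$ are the $\Gamma$-orbits of faces of $Z^n$, one orbit being incident to (below) another if some representative of the first is contained in some representative of the second. **Proposition.** Let $n\ge2$ and let $\mathcal K$ be a closed cubical complex of dimension $n$ which is strongly connected and in which the star of each vertex is strongly connected. Suppose that every $(n-2)$-face of $\mathcal K$ is contained in exactly four facets. Then $\mathcal K$ is non-spherical, that is, $|\mathcal K|$ is not homeomorphic to the sphere $S^n$. Moreover: (i) if $|\mathcal K|$ is simply connected, then $\mathcal K$ is isomorphic to $Z^n$, i.e. there is an incidence-preserving bijection in both directions between the non-empty proper faces of $\mathcal K$ and the non-empty faces of $Z^n$; (ii) otherwise, there is a torsion-free subgroup $\Gamma$ of the symmetry group of $Z^n$, no non-identity element of which has a fixed point in $\mathbb R^n$, such that $\mathcal K$ is isomorphic to the quotient $Z^n/\Gamma$. -/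

import Mathlib

/-! ### Cubical complexes as lattices -/

/-- `x` is a combinatorial `k`-cube: the faces below `x`, the empty face `⊥` included, form the
face lattice of the `k`-dimensional hypercube.  The vertices of the hypercube are the points of
`{0,1}^k = (Fin k → Bool)`, its non-empty faces are the intervals `[a, b]` of this Boolean lattice,
and `Interval (Fin k → Bool)` is the set of these intervals together with the empty one, ordered
by inclusion. -/
def IsCubeFace {L : Type*} [Lattice L] (k : ℕ) (x : L) : Prop :=
  Nonempty (Set.Iic x ≃o Interval (Fin k → Bool))

/-- Any two facets containing `x` are joined by a sequence of facets containing `x` in which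
consecutive facets share a common face of codimension one containing `x`.  (For `x = ⊥` this is
strong connectedness of the complex, for a vertex `x` it is strong connectedness of its star.) -/
def FacetsConnectedAbove {L : Type*} [Lattice L] [BoundedOrder L] (x : L) : Prop :=
  ∀ F G : L, IsCoatom F → IsCoatom G → x ≤ F → x ≤ G →
    Relation.ReflTransGen
      (fun A B : L => IsCoatom A ∧ IsCoatom B ∧ ∃ r : L, x ≤ r ∧ r ⋖ A ∧ r ⋖ B) F G

/-- The lattice `L` is (the face lattice of) a closed connected cubical complex of dimension `n`.
The elements of `L` are the faces, `⊥` is the empty face, the improper top element `⊤` is added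
above all faces, and the facets are the coatoms. -/
structure IsClosedCubicalComplex (n : ℕ) (L : Type*) [Lattice L] [BoundedOrder L] : Prop where
  /-- the complex has a face -/
  bot_ne_top : (⊥ : L) ≠ ⊤
  /-- every face is contained in a facet -/
  exists_facet : ∀ x : L, x ≠ ⊤ → ∃ F : L, IsCoatom F ∧ x ≤ F
  /-- the facets are combinatorial `n`-cubes -/
  facet_cube : ∀ F : L, IsCoatom F → IsCubeFace n F
  /-- the complex is closed: each `(n-1)`-face lies in exactly two facets -/
  closed : ∀ k : ℕ, k + 1 = n → ∀ x : L, IsCubeFace k x → {F : L | IsCoatom F ∧ x ≤ F}.ncard = 2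
  /-- the complex is strongly connected -/
  connected : FacetsConnectedAbove (⊥ : L)
  /-- the star of each vertex is strongly connected -/
  star_connected : ∀ v : L, IsAtom v → FacetsConnectedAbove v

/-- The poset of non-empty faces of the complex with face lattice `L`. -/
abbrev ProperFace (L : Type*) [Lattice L] [BoundedOrder L] : Type _ := {x : L // x ≠ ⊥ ∧ x ≠ ⊤}

/-! ### Geometric realization -/

/-- The geometric realization of the order complex of a poset `P`: formal convex combinations
of elements of `P` whose support is a (finite) chain. -/
def OrderComplex (P : Type*) [PartialOrder P] : Type _ :=
  {w : P →₀ ℝ // (∀ x, 0 ≤ w x) ∧ IsChain (· ≤ ·) (w.support : Set P) ∧ (w.sum fun _ a => a) = 1}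

/-- The closed simplex of the order complex that is spanned by `c`. -/
def OrderComplex.Simplex {P : Type*} [PartialOrder P] (c : Finset P) : Type _ :=
  {w : OrderComplex P // w.1.support ⊆ c}

/-- A simplex carries the topology given by its barycentric coordinates. -/
instance OrderComplex.instTopologicalSpaceSimplex {P : Type*} [PartialOrder P] (c : Finset P) :
    TopologicalSpace (OrderComplex.Simplex c) :=
  TopologicalSpace.induced (fun (w : OrderComplex.Simplex c) (x : P) => w.1.1 x)
    (inferInstance : TopologicalSpace (P → ℝ))

/-- The weak topology: a set is open iff its trace on each closed simplex is open. -/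
instance OrderComplex.instTopologicalSpace {P : Type*} [PartialOrder P] :
    TopologicalSpace (OrderComplex P) :=
  ⨆ c : {c : Finset P // IsChain (· ≤ ·) (c : Set P)},
    TopologicalSpace.coinduced (fun w : OrderComplex.Simplex c.1 => w.1) inferInstance

/-- The geometric realization of a cubical complex, by barycentric subdivision: the simplices are
the chains of non-empty faces. -/
abbrev Realization (L : Type*) [Lattice L] [BoundedOrder L] : Type _ := OrderComplex (ProperFace L)

/-! ### The cubical lattice `Z^n` and its quotients -/

/-- The non-empty faces of the cubical lattice `Z^n`, i.e. of the tessellation of `ℝ^n` by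
the unit cubes with integral vertices: products of `n` factors, each of them an integral point
`{k}` or an integral unit segment `[k, k+1]`.  They are ordered by inclusion. -/
abbrev ZFace (n : ℕ) : Type :=
  {s : Set (Fin n → ℝ) // ∃ a b : Fin n → ℤ, (∀ i, b i = a i ∨ b i = a i + 1) ∧
    s = Set.Icc (fun i => (a i : ℝ)) (fun i => (b i : ℝ))}

/-- The symmetry group of `Z^n`, acting on `ℝ^n`: the semidirect product of the group of signed
permutations of the coordinates (the Coxeter group `B_n`) and of the group of integral
translations. -/
def latticeSymmetryGroup (n : ℕ) : Subgroup (Equiv.Perm (Fin n → ℝ)) where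
  carrier := {g | ∃ (σ : Equiv.Perm (Fin n)) (ε : Fin n → ℤˣ) (t : Fin n → ℤ),
    ∀ x i, g x i = ((ε i : ℤ) : ℝ) * x (σ i) + (t i : ℝ)}
  one_mem' := ⟨1, 1, 0, fun x i => by simp⟩
  mul_mem' := by
    rintro g h ⟨σ, ε, t, hg⟩ ⟨τ, δ, u, hh⟩
    refine ⟨σ.trans τ, fun i => ε i * δ (σ i), fun i => (ε i : ℤ) * u (σ i) + t i,
      fun x i => ?_⟩
    rw [Equiv.Perm.mul_apply, hg, hh]
    push_cast
    simp only [Equiv.trans_apply]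
    ring
  inv_mem' := by
    rintro g ⟨σ, ε, t, hg⟩
    refine ⟨σ.symm, fun i => ε (σ.symm i), fun i => -((ε (σ.symm i) : ℤ) * t (σ.symm i)),
      fun x i => ?_⟩
    have h := hg (g⁻¹ x) (σ.symm i)
    have hx : g (g⁻¹ x) = x := by simp
    rw [hx, Equiv.apply_symm_apply] at h
    rw [h]
    rcases Int.units_eq_one_or (ε (σ.symm i)) with e | e <;> simp [e]

/-- Two faces of `Z^n` are equivalent if an element of `Γ` maps one onto the other. -/
def orbitSetoid {n : ℕ} (Γ : Subgroup (Equiv.Perm (Fin n → ℝ))) : Setoid (ZFace n) where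
  r F G := ∃ g ∈ Γ, g '' F.1 = G.1
  iseqv :=
    { refl := fun F => ⟨1, Γ.one_mem, by simp⟩
      symm := by
        rintro F G ⟨g, hg, h⟩
        refine ⟨g⁻¹, Γ.inv_mem hg, ?_⟩
        rw [← h, ← Set.image_comp]
        ext x
        simp
      trans := by
        rintro F G H ⟨g, hg, h⟩ ⟨k, hk, h'⟩
        refine ⟨k * g, Γ.mul_mem hk hg, ?_⟩
        rw [← h', ← h, ← Set.image_comp]
        rfl }

/-- The non-empty faces of the quotient `Z^n / Γ`: the `Γ`-orbits of the faces of `Z^n`. -/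
def ZQuotient {n : ℕ} (Γ : Subgroup (Equiv.Perm (Fin n → ℝ))) : Type := Quotient (orbitSetoid Γ)

/-- Incidence in the quotient: an orbit is below another one iff some representative of the first
is a face of some representative of the second. -/
instance ZQuotient.instLE {n : ℕ} (Γ : Subgroup (Equiv.Perm (Fin n → ℝ))) : LE (ZQuotient Γ) where
  le p q := ∃ F G : ZFace n, (Quotient.mk (orbitSetoid Γ) F : ZQuotient Γ) = p ∧
    (Quotient.mk (orbitSetoid Γ) G : ZQuotient Γ) = q ∧ F ≤ G

/-!
Following the facets of the complex by reflections, one unrolls it onto the cubical lattice.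

A *frame* identifies the standard cube with a facet. A frame can be reflected across each wall of
its facet: since the wall lies in exactly two facets, there is one facet behind it, and a frame of
that facet is determined by its values on the wall (`IsFlat.exists_neighbor`,
`IsFlat.neighbor_unique`). Reflections across two walls that meet in a face of codimension two
commute (`IsFlat.mirror_comm`): this is where the four facets around such a face are used, together
with the lattice property, which forbids two facets to share more than one wall. Hence the
reflections of one frame form a family indexed by `ℤ ^ n`, and its members fit together to a
*developing map* from the faces of the cubical lattice to the faces of the complex
(`IsFlat.exists_developing`). It is determined by its values on one cube
(`IsDeveloping.eq_of_agree`).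

The developing map is injective on the star of each vertex, by an induction on the number of
directions in which two cubes of the star differ (`IsDeveloping.cube_inj_of_vertex_le`,
`IsDeveloping.le_of_vertex_le`); it maps onto the star of the image since that star is strongly
connected. So it is a covering of partially ordered sets (`IsDeveloping.isPosetCovering`). Two cubes
over the same facet differ by a symmetry of the lattice, which preserves the developing map by
uniqueness; therefore the symmetries of the developing map form a group `Γ` that is transitive on
the fibres (`IsDeveloping.exists_cellSymm`), and the complex is the quotient by `Γ`
(`IsDeveloping.nonempty_orderIso_quotient`). An element of `Γ` with a fixed point maps a face, and
then a vertex and all the edges at it, to itself, so it is the identity. An element of finite order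
has a fixed point, the barycentre of an orbit.

On the order complexes, a covering of partially ordered sets induces a covering map
(`IsPosetCovering.isCoveringMap`). Its source is path connected, so it is injective if the base is
simply connected; then the developing map is an isomorphism. It is also injective if the base is a
sphere of dimension at least two, by gluing sections over the complements of two antipodal points
(`IsCoveringMap.eq_of_joined_of_sphere`). But then the lattice would have only finitely many faces,
because the sphere is compact.
-/

section

/-! ### Faces of the standard cube -/

/-- The non-empty faces of the unit segment: its two end points `pt false` and `pt true`, and the
whole segment `all`. The non-empty faces of the `n`-cube are the functions `Fin n → Seg`. -/
inductive Seg : Type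
  | pt (s : Bool) : Seg
  | all : Seg
  deriving DecidableEq

namespace Seg

instance : PartialOrder Seg where
  le a b := a = b ∨ b = all
  le_refl a := Or.inl rfl
  le_trans := by
    rintro a b c (rfl | rfl) (rfl | rfl) <;> simp
  le_antisymm := by
    rintro a b (rfl | rfl) (h | rfl) <;> simp_all

instance : OrderTop Seg where
  top := all
  le_top _ := Or.inr rfl

theorem le_def {a b : Seg} : a ≤ b ↔ a = b ∨ b = all := Iff.rfl

theorem top_eq : (⊤ : Seg) = all := rfl

@[simp] theorem le_pt {a : Seg} {s : Bool} : a ≤ pt s ↔ a = pt s := by simp [le_def]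

/-- The reflection of the segment that swaps its end points. -/
def reflect : Bool → Seg → Seg
  | b, pt s => pt (xor b s)
  | _, all => all

@[simp] theorem reflect_reflect (b : Bool) (a : Seg) : reflect b (reflect b a) = a := by
  cases a <;> simp [reflect]

@[simp] theorem reflect_all (b : Bool) : reflect b all = all := rfl

@[simp] theorem reflect_le_reflect {b : Bool} {a c : Seg} : reflect b a ≤ reflect b c ↔ a ≤ c := by
  cases a <;> cases c <;> simp [reflect, le_def]

end Seg

open Seg

variable {n : ℕ}

/-- The face of codimension one of the cube on which the `i`-th coordinate is `s`. -/
def coat (i : Fin n) (s : Bool) : Fin n → Seg := Function.update ⊤ i (pt s)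

@[simp] theorem coat_self (i : Fin n) (s : Bool) : coat i s i = pt s := by simp [coat]

theorem coat_of_ne {i j : Fin n} (s : Bool) (h : j ≠ i) : coat i s j = all := by
  simp [coat, h, top_eq]

theorem le_coat {c : Fin n → Seg} {i : Fin n} {s : Bool} : c ≤ coat i s ↔ c i = pt s := by
  constructor
  · intro h
    simpa using h i
  · intro h j
    by_cases e : j = i
    · subst e; simp [h]
    · rw [coat_of_ne s e]; exact le_top

theorem coat_ne_top (i : Fin n) (s : Bool) : coat i s ≠ ⊤ := fun h => by
  have := congrFun h i
  simp [top_eq] at this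

theorem coat_inj {i j : Fin n} {s t : Bool} : coat i s = coat j t ↔ i = j ∧ s = t := by
  constructor
  · intro h
    have h1 : coat j t i = pt s := by rw [← h]; simp
    by_cases e : i = j
    · subst e; simpa [eq_comm] using h1
    · rw [coat_of_ne t e] at h1; cases h1
  · rintro ⟨rfl, rfl⟩; rfl

theorem exists_le_coat {c : Fin n → Seg} (h : c ≠ ⊤) : ∃ i s, c ≤ coat i s := by
  by_contra! H
  apply h
  funext i
  cases e : c i with
  | pt s => exact absurd (le_coat.2 e) (H i s)
  | all => rfl

theorem eq_of_coat_le {d : Fin n → Seg} {i : Fin n} {s : Bool} (h : coat i s ≤ d) (hd : d ≠ ⊤) :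
    d = coat i s := by
  obtain ⟨j, t, hj⟩ := exists_le_coat hd
  have := le_coat.1 (h.trans hj)
  have e : i = j := by
    by_contra e
    rw [coat_of_ne s (Ne.symm e)] at this; cases this
  subst e
  simp at this; subst this
  exact le_antisymm hj h

/-- A face of the cube is determined by the faces of codimension one that contain it. -/
theorem eq_of_forall_coat {c d : Fin n → Seg} (h : ∀ i s, c ≤ coat i s ↔ d ≤ coat i s) : c = d := by
  funext i
  simp only [le_coat] at h
  cases e : c i with
  | pt s => exact ((h i s).1 e).symm
  | all =>
    cases e' : d i with
    | all => rfl
    | pt s => rw [(h i s).2 e'] at e; exact e.symm ▸ rfl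

/-- The signed permutation of the coordinates, acting on the faces of the cube. -/
def signedPerm (σ : Equiv.Perm (Fin n)) (b : Fin n → Bool) : (Fin n → Seg) ≃o (Fin n → Seg) where
  toFun c i := reflect (b i) (c (σ i))
  invFun c i := reflect (b (σ.symm i)) (c (σ.symm i))
  left_inv c := by funext i; simp
  right_inv c := by funext i; simp
  map_rel_iff' := by
    intro c d
    simp only [Equiv.coe_fn_mk, Pi.le_def, reflect_le_reflect]
    exact ⟨fun h i => by simpa using h (σ.symm i), fun h i => h _⟩

@[simp] theorem signedPerm_apply (σ : Equiv.Perm (Fin n)) (b : Fin n → Bool) (c : Fin n → Seg)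
    (i : Fin n) : signedPerm σ b c i = reflect (b i) (c (σ i)) := rfl

theorem signedPerm_coat (σ : Equiv.Perm (Fin n)) (b : Fin n → Bool) (i : Fin n) (s : Bool) :
    signedPerm σ b (coat (σ i) s) = coat i (xor (b i) s) := by
  funext j
  by_cases e : j = i
  · subst e; simp [reflect]
  · rw [coat_of_ne _ e, signedPerm_apply, coat_of_ne _ (σ.injective.ne e), reflect_all]

/-! ### Frames -/

variable {L : Type*} [Lattice L] [BoundedOrder L]

/-- A frame of the complex `L`: an identification of the faces of the standard cube with the
non-empty faces of a facet of `L`. The facet is `φ ⊤`. -/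
structure IsFrame (φ : (Fin n → Seg) → L) : Prop where
  coatom : IsCoatom (φ ⊤)
  le_iff : ∀ {c d}, φ c ≤ φ d ↔ c ≤ d
  ne_bot : ∀ c, φ c ≠ ⊥
  surj : ∀ x, x ≠ ⊥ → x ≤ φ ⊤ → ∃ c, φ c = x

namespace IsFrame

variable {φ ψ : (Fin n → Seg) → L}

theorem inj (h : IsFrame φ) {c d : Fin n → Seg} (e : φ c = φ d) : c = d :=
  le_antisymm (h.le_iff.1 e.le) (h.le_iff.1 e.ge)

theorem le_top (h : IsFrame φ) (c : Fin n → Seg) : φ c ≤ φ ⊤ := h.le_iff.2 _root_.le_top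

theorem comp (h : IsFrame φ) (e : (Fin n → Seg) ≃o (Fin n → Seg)) : IsFrame (φ ∘ e) where
  coatom := by simpa using h.coatom
  le_iff := by intro c d; simp [h.le_iff]
  ne_bot c := h.ne_bot _
  surj x hx hx' := by
    obtain ⟨c, rfl⟩ := h.surj x hx (by simpa using hx')
    exact ⟨e.symm c, by simp⟩

/-- Two frames of the same facet that agree on the faces of codimension one are equal. -/
theorem ext_coat (h : IsFrame φ) (h' : IsFrame ψ) (ht : φ ⊤ = ψ ⊤)
    (hc : ∀ i s, φ (coat i s) = ψ (coat i s)) : φ = ψ := by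
  funext c
  obtain ⟨d, hd⟩ := h'.surj (φ c) (h.ne_bot c) (ht ▸ h.le_top c)
  rw [← hd, eq_of_forall_coat (c := c) (d := d)]
  intro i s
  rw [← h.le_iff, hc, ← hd, h'.le_iff]

/-- Two frames of the same facet have the same faces of codimension one. -/
theorem exists_coat (h : IsFrame φ) (h' : IsFrame ψ) (ht : φ ⊤ = ψ ⊤) (i : Fin n) (s : Bool) :
    ∃ j t, φ (coat i s) = ψ (coat j t) := by
  obtain ⟨d, hd⟩ := h'.surj (φ (coat i s)) (h.ne_bot _) (ht ▸ h.le_top _)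
  have hd' : d ≠ ⊤ := by
    rintro rfl
    exact coat_ne_top i s (h.inj (hd.symm.trans ht.symm))
  obtain ⟨j, t, hj⟩ := exists_le_coat hd'
  refine ⟨j, t, ?_⟩
  obtain ⟨e, he⟩ := h.surj (ψ (coat j t)) (h'.ne_bot _) (ht ▸ h'.le_top _)
  have h1 : coat i s ≤ e := by rw [← h.le_iff, he, ← hd, h'.le_iff]; exact hj
  have h2 : e ≠ ⊤ := by
    rintro rfl
    exact coat_ne_top j t (h'.inj (he.symm.trans ht))
  rw [← eq_of_coat_le h1 h2, he]

theorem coat_opposite (h : IsFrame φ) (h' : IsFrame ψ) (ht : φ ⊤ = ψ ⊤) {i j : Fin n} {s t : Bool}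
    (e : φ (coat i s) = ψ (coat j t)) : φ (coat i !s) = ψ (coat j !t) := by
  obtain ⟨k, u, hk⟩ := h.exists_coat h' ht i (!s)
  have hkj : k = j := by
    by_contra hne
    -- otherwise the two faces have a common face, but opposite faces of a cube are disjoint
    let d : Fin n → Seg := Function.update (coat j t) k (pt u)
    have hd1 : d ≤ coat k u := le_coat.2 (by simp [d])
    have hd2 : d ≤ coat j t := le_coat.2 (by simp [d, Ne.symm hne])
    obtain ⟨c, hc⟩ := h.surj (ψ d) (h'.ne_bot d) (ht ▸ h'.le_top d)
    have h1 : c ≤ coat i s := by rw [← h.le_iff, hc, e, h'.le_iff]; exact hd2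
    have h2 : c ≤ coat i !s := by rw [← h.le_iff, hc, hk, h'.le_iff]; exact hd1
    rw [le_coat] at h1 h2
    rw [h1] at h2; simp at h2
  subst hkj
  have hut : u ≠ t := by
    rintro rfl
    have := (coat_inj.1 (h.inj (e.trans hk.symm))).2
    simp at this
  have : u = !t := by cases u <;> cases t <;> simp_all
  rw [hk, this]

/-- Two frames of the same facet that agree on a face of codimension one are equal. -/
theorem ext_of_coat (h : IsFrame φ) (h' : IsFrame ψ) (ht : φ ⊤ = ψ ⊤) {i : Fin n} {s : Bool}
    (hc : ∀ c : Fin n → Seg, c i = pt s → φ c = ψ c) : φ = ψ := by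
  have hi : φ (coat i s) = ψ (coat i s) := hc _ (by simp)
  refine h.ext_coat h' ht fun k u => ?_
  by_cases hk : k = i
  · subst hk
    by_cases hu : u = s
    · subst hu; exact hi
    · have : u = !s := by cases u <;> cases s <;> simp_all
      subst this
      exact h.coat_opposite h' ht hi
  · obtain ⟨l, w, hl⟩ := h.exists_coat h' ht k u
    let c : Fin n → Seg := Function.update (coat k u) i (pt s)
    have hci : c i = pt s := by simp [c]
    have hck : c ≤ coat k u := le_coat.2 (by simp [c, hk])
    have hcl : c ≤ coat l w := by rw [← h'.le_iff, ← hl, ← hc c hci, h.le_iff]; exact hck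
    have hcl' := le_coat.1 hcl
    by_cases e1 : l = i
    · subst e1
      rw [hci] at hcl'
      cases hcl'
      exact absurd (coat_inj.1 (h.inj (hl.trans hi.symm))).1 hk
    · by_cases e2 : l = k
      · subst e2
        simp only [c, ne_eq, e1, not_false_eq_true, Function.update_of_ne, coat_self] at hcl'
        cases hcl'; exact hl
      · simp only [c, ne_eq, e1, not_false_eq_true, Function.update_of_ne] at hcl'
        rw [coat_of_ne u e2] at hcl'; cases hcl'

/-- Two frames of the same facet differ by a signed permutation of the coordinates. -/
theorem exists_signedPerm (h : IsFrame φ) (h' : IsFrame ψ) (ht : φ ⊤ = ψ ⊤) :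
    ∃ σ b, ∀ c, φ (signedPerm σ b c) = ψ c := by
  choose f g hfg using fun i => h.exists_coat h' ht i false
  have hf : Function.Injective f := by
    intro i j hij
    by_contra hne
    by_cases e : g i = g j
    · exact hne (coat_inj.1 (h.inj ((hfg i).trans (by rw [hij, e, ← hfg j])))).1
    · have e' : g i = !g j := by cases h1 : g i <;> cases h2 : g j <;> simp_all
      have := h.coat_opposite h' ht (hfg j)
      rw [← e', ← hij, ← hfg i] at this
      exact hne (coat_inj.1 (h.inj this)).1.symm
  have hfg' : ∀ i s, φ (coat i s) = ψ (coat (f i) (xor (g i) s)) := by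
    intro i s
    cases s
    · simpa using hfg i
    · simpa using h.coat_opposite h' ht (hfg i)
  let σ : Equiv.Perm (Fin n) := Equiv.ofBijective f (Finite.injective_iff_bijective.1 hf)
  refine ⟨σ, g, ?_⟩
  have := (h.comp (signedPerm σ g)).ext_coat h' (by simpa using ht) ?_
  · exact fun c => congrFun this c
  · intro i s
    obtain ⟨i, rfl⟩ := σ.surjective i
    rw [Function.comp_apply, signedPerm_coat, hfg']
    simp only [← Bool.xor_assoc, Bool.xor_self, Bool.false_xor]
    rfl

/-- Any face of codimension one can be moved to any other by a symmetry of the cube. -/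
theorem exists_comp_coat (h : IsFrame φ) (i j : Fin n) (s t : Bool) :
    ∃ ψ : (Fin n → Seg) → L, IsFrame ψ ∧ ψ ⊤ = φ ⊤ ∧ ψ (coat i s) = φ (coat j t) := by
  let σ := Equiv.swap i j
  refine ⟨φ ∘ signedPerm σ (fun _ => xor s t), h.comp _, by simp, ?_⟩
  have : i = σ j := by simp [σ]
  rw [Function.comp_apply, this, signedPerm_coat]
  cases s <;> cases t <;> rfl

end IsFrame

end

section

open Seg
variable {n : ℕ} {L : Type*} [Lattice L] [BoundedOrder L]

/-! ### Reflecting a frame into the adjacent facet -/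

/-- The local conditions on a closed cubical complex with four facets around each face of
codimension two, expressed by frames. -/
structure IsFlat (n : ℕ) (L : Type*) [Lattice L] [BoundedOrder L] : Prop where
  exists_frame : ∀ F : L, IsCoatom F → ∃ φ : (Fin n → Seg) → L, IsFrame φ ∧ φ ⊤ = F
  two : ∀ φ : (Fin n → Seg) → L, IsFrame φ → ∀ i s,
    {F : L | IsCoatom F ∧ φ (coat i s) ≤ F}.ncard = 2
  four : ∀ φ : (Fin n → Seg) → L, IsFrame φ → ∀ i j s t, i ≠ j →
    {F : L | IsCoatom F ∧ φ (Function.update (coat i s) j (pt t)) ≤ F}.ncard = 4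

theorem IsCoatom.eq_of_le_coatom {F G : L} (hF : IsCoatom F) (hG : IsCoatom G) (h : F ≤ G) :
    F = G := (hF.le_iff.1 h).resolve_left hG.1 |>.symm

namespace IsFlat

variable {φ ψ : (Fin n → Seg) → L}

/-- No three facets share a face of codimension one. -/
theorem not_three (hL : IsFlat n L) (h : IsFrame φ) {i : Fin n} {s : Bool} {A B C : L}
    (hA : IsCoatom A) (hB : IsCoatom B) (hC : IsCoatom C) (hA' : φ (coat i s) ≤ A)
    (hB' : φ (coat i s) ≤ B) (hC' : φ (coat i s) ≤ C) (hAB : A ≠ B) (hAC : A ≠ C) (hBC : B ≠ C) :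
    False := by
  have h2 := hL.two φ h i s
  have hfin : {F : L | IsCoatom F ∧ φ (coat i s) ≤ F}.Finite :=
    Set.finite_of_ncard_ne_zero (by rw [h2]; norm_num)
  have hs : ({A, B, C} : Set L) ⊆ {F : L | IsCoatom F ∧ φ (coat i s) ≤ F} := by
    rintro x (rfl | rfl | rfl)
    exacts [⟨hA, hA'⟩, ⟨hB, hB'⟩, ⟨hC, hC'⟩]
  have := Set.ncard_le_ncard hs hfin
  rw [h2, Set.ncard_eq_three.2 ⟨A, B, C, hAB, hAC, hBC, rfl⟩] at this
  omega

theorem exists_other (hL : IsFlat n L) (h : IsFrame φ) (i : Fin n) (s : Bool) :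
    ∃ F, IsCoatom F ∧ φ (coat i s) ≤ F ∧ F ≠ φ ⊤ := by
  obtain ⟨A, B, hAB, he⟩ := Set.ncard_eq_two.1 (hL.two φ h i s)
  have hA : A ∈ {F : L | IsCoatom F ∧ φ (coat i s) ≤ F} := by rw [he]; simp
  have hB : B ∈ {F : L | IsCoatom F ∧ φ (coat i s) ≤ F} := by rw [he]; simp
  by_cases e : A = φ ⊤
  · exact ⟨B, hB.1, hB.2, fun e' => hAB (e.trans e'.symm)⟩
  · exact ⟨A, hA.1, hA.2, e⟩

/-- A face of codimension one of a facet is also a face of codimension one of the facet `F` behind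
it. A wall of `F` above it has a further facet on it, which by closedness is the given facet. -/
theorem exists_frame_coat (hL : IsFlat n L) (h : IsFrame φ) {i : Fin n} {s : Bool} {F : L}
    (hF : IsCoatom F) (hr : φ (coat i s) ≤ F) (hne : F ≠ φ ⊤) :
    ∃ ψ : (Fin n → Seg) → L, IsFrame ψ ∧ ψ ⊤ = F ∧ ψ (coat i s) = φ (coat i s) := by
  obtain ⟨ψ, hψ, rfl⟩ := hL.exists_frame F hF
  obtain ⟨d, hd⟩ := hψ.surj _ (h.ne_bot _) hr
  have hdt : d ≠ ⊤ := by
    rintro rfl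
    exact hne (hF.eq_of_le_coatom h.coatom (hd ▸ h.le_top _))
  obtain ⟨j, t, hj⟩ := exists_le_coat hdt
  have hle : φ (coat i s) ≤ ψ (coat j t) := by rw [← hd, hψ.le_iff]; exact hj
  have hF2 : ψ (coat j t) ≤ φ ⊤ := by
    obtain ⟨G, hG, hG1, hG2⟩ := hL.exists_other hψ j t
    by_cases e : G = φ ⊤
    · exact e ▸ hG1
    · exact (hL.not_three h h.coatom hF hG (h.le_top _) hr (hle.trans hG1) hne.symm
        (Ne.symm e) hG2.symm).elim
  obtain ⟨c, hc⟩ := h.surj _ (hψ.ne_bot _) hF2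
  have hct : c ≠ ⊤ := by
    rintro rfl
    exact hne (h.coatom.eq_of_le_coatom hF (hc ▸ hψ.le_top _)).symm
  have : c = coat i s := eq_of_coat_le (by rw [← h.le_iff, hc]; exact hle) hct
  subst this
  obtain ⟨χ, hχ, hχ1, hχ2⟩ := hψ.exists_comp_coat i j s t
  exact ⟨χ, hχ, hχ1, hχ2.trans hc.symm⟩

/-- A frame of a facet can be reflected into the adjacent facet across each face of codimension
one. -/
theorem exists_neighbor (hL : IsFlat n L) (h : IsFrame φ) (i : Fin n) (s : Bool) :
    ∃ ψ : (Fin n → Seg) → L, IsFrame ψ ∧ ψ ⊤ ≠ φ ⊤ ∧ ∀ c, c i = pt s → ψ c = φ c := by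
  obtain ⟨F, hF, hr, hne⟩ := hL.exists_other h i s
  obtain ⟨χ, hχ, rfl, hχr⟩ := hL.exists_frame_coat h hF hr hne
  have key : ∀ c : Fin n → Seg, c i = pt s → ∃ d : Fin n → Seg, d i = pt s ∧ χ d = φ c := by
    intro c hc
    have hc' : φ c ≤ χ (coat i s) := by rw [hχr, h.le_iff]; exact le_coat.2 hc
    obtain ⟨d, hd⟩ := hχ.surj _ (h.ne_bot c) (hc'.trans (hχ.le_top _))
    exact ⟨d, le_coat.1 (by rw [← hχ.le_iff, hd]; exact hc'), hd⟩
  have key' : ∀ c : Fin n → Seg, c i = pt s → ∃ d : Fin n → Seg, d i = pt s ∧ φ d = χ c := by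
    intro c hc
    have hc' : χ c ≤ φ (coat i s) := by rw [← hχr, hχ.le_iff]; exact le_coat.2 hc
    obtain ⟨d, hd⟩ := h.surj _ (hχ.ne_bot c) (hc'.trans (h.le_top _))
    exact ⟨d, le_coat.1 (by rw [← h.le_iff, hd]; exact hc'), hd⟩
  choose α hα hαφ using fun c : Fin n → Seg => key (Function.update c i (pt s)) (by simp)
  have hαle : ∀ {c d : Fin n → Seg}, α c ≤ α d ↔
      Function.update c i (pt s) ≤ Function.update d i (pt s) := by
    intro c d
    rw [← hχ.le_iff, hαφ, hαφ, h.le_iff]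
  have hαu : ∀ (c : Fin n → Seg) x, α (Function.update c i x) = α c := fun c x =>
    hχ.inj (by rw [hαφ, hαφ]; simp)
  have hαt : Function.update (α ⊤) i ((⊤ : Fin n → Seg) i) = ⊤ := by
    have h1 : coat i s ≤ α ⊤ := by
      rw [← hχ.le_iff, hαφ, hχr]; exact le_rfl
    have h2 := eq_of_coat_le h1 (fun e => by
      have := congrFun e i; rw [hα] at this; cases this)
    rw [h2]; simp [coat]
  -- the identification of the common face extends to the facet as a product with the segment
  refine ⟨fun c => χ (Function.update (α c) i (c i)), ⟨?_, ?_, ?_, ?_⟩, ?_, ?_⟩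
  · simpa only [hαt] using hχ.coatom
  · intro c d
    have h1 : ∀ {x y : Fin n → Seg} {a b : Seg}, Function.update x i a ≤ Function.update y i b ↔
        a ≤ b ∧ Function.update x i (pt s) ≤ Function.update y i (pt s) := by
      intro x y a b
      simp only [update_le_update_iff]
      exact ⟨fun h => ⟨h.1, le_rfl, h.2⟩, fun h => ⟨h.1, h.2.2⟩⟩
    rw [hχ.le_iff, h1]
    have h2 : ∀ c, Function.update (α c) i (pt s) = α c := fun c => by
      rw [← hα c]; simp
    rw [h2, h2, hαle]
    conv_rhs => rw [← Function.update_eq_self i c, ← Function.update_eq_self i d, h1]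
  · exact fun c => hχ.ne_bot _
  · intro x hx hx'
    have hx'' : x ≤ χ ⊤ := hx'.trans (hχ.le_top _)
    obtain ⟨e, rfl⟩ := hχ.surj x hx hx''
    obtain ⟨d, hd, hd'⟩ := key' (Function.update e i (pt s)) (by simp)
    refine ⟨Function.update d i (e i), ?_⟩
    have : α d = Function.update e i (pt s) := hχ.inj (by
      rw [hαφ, ← hd', ← hd]; simp)
    simp only [hαu, this]
    simp
  · simpa only [hαt] using hne
  · intro c hc
    have h2 : Function.update (α c) i (c i) = α c := by rw [hc, ← hα c]; simp
    simp only [h2, hαφ]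
    rw [← hc]; simp

/-- The reflected frame is unique, because the facet behind the wall is unique and two frames of it
that agree on the wall are equal. -/
theorem neighbor_unique (hL : IsFlat n L) (h : IsFrame φ) {i : Fin n} {s : Bool}
    {ψ χ : (Fin n → Seg) → L} (hψ : IsFrame ψ) (hχ : IsFrame χ) (h1 : ψ ⊤ ≠ φ ⊤) (h2 : χ ⊤ ≠ φ ⊤)
    (h1' : ∀ c, c i = pt s → ψ c = φ c) (h2' : ∀ c, c i = pt s → χ c = φ c) : ψ = χ := by
  have ht : ψ ⊤ = χ ⊤ := by
    by_contra hne
    refine hL.not_three (i := i) (s := s) h h.coatom hψ.coatom hχ.coatom (h.le_top _) ?_ ?_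
      h1.symm h2.symm hne
    · rw [← h1' _ (coat_self i s)]; exact hψ.le_top _
    · rw [← h2' _ (coat_self i s)]; exact hχ.le_top _
  exact hψ.ext_of_coat hχ ht (i := i) (s := s) fun c hc => (h1' c hc).trans (h2' c hc).symm

/-- The frame of the adjacent facet across the face `coat i s`, obtained by reflection: it agrees
with the given frame on the common face. -/
noncomputable def mirror (hL : IsFlat n L) (i : Fin n) (s : Bool)
    (φ : {φ : (Fin n → Seg) → L // IsFrame φ}) : {φ : (Fin n → Seg) → L // IsFrame φ} :=
  ⟨(hL.exists_neighbor φ.2 i s).choose, (hL.exists_neighbor φ.2 i s).choose_spec.1⟩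

theorem mirror_top_ne (hL : IsFlat n L) (i : Fin n) (s : Bool)
    (φ : {φ : (Fin n → Seg) → L // IsFrame φ}) : (hL.mirror i s φ).1 ⊤ ≠ φ.1 ⊤ :=
  (hL.exists_neighbor φ.2 i s).choose_spec.2.1

theorem mirror_apply (hL : IsFlat n L) {i : Fin n} {s : Bool}
    (φ : {φ : (Fin n → Seg) → L // IsFrame φ}) {c : Fin n → Seg} (hc : c i = pt s) :
    (hL.mirror i s φ).1 c = φ.1 c :=
  (hL.exists_neighbor φ.2 i s).choose_spec.2.2 c hc

theorem mirror_mirror (hL : IsFlat n L) (i : Fin n) (s : Bool)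
    (φ : {φ : (Fin n → Seg) → L // IsFrame φ}) : hL.mirror i s (hL.mirror i s φ) = φ :=
  Subtype.ext <| hL.neighbor_unique (hL.mirror i s φ).2 (i := i) (s := s) (Subtype.prop _) φ.2
    (hL.mirror_top_ne _ _ _) (hL.mirror_top_ne _ _ _).symm (fun _ hc => hL.mirror_apply _ hc)
    (fun _ hc => (hL.mirror_apply _ hc).symm)

/-- A proper face of the cube that contains a face of codimension two is contained in one of
the two faces of codimension one around it. -/
theorem _root_.le_coat_or_le_coat {c : Fin n → Seg} {i j : Fin n} {s t : Bool}
    (h : Function.update (coat i s) j (pt t) ≤ c) (hc : c ≠ ⊤) : c ≤ coat i s ∨ c ≤ coat j t := by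
  obtain ⟨k, u, hk⟩ := exists_le_coat hc
  have h1 := le_coat.1 (h.trans hk)
  by_cases e : k = j
  · subst e
    simp at h1; subst h1; exact Or.inr hk
  · simp only [ne_eq, e, not_false_eq_true, Function.update_of_ne] at h1
    by_cases e' : k = i
    · subst e'
      simp at h1; subst h1; exact Or.inl hk
    · rw [coat_of_ne s e'] at h1; cases h1

/-- A facet meets another facet in at most one face of codimension one: the meet of the two facets
is a proper face of each of them. -/
theorem _root_.IsFrame.coat_eq_of_le (h : IsFrame φ) {G : L} (hG : IsCoatom G) (hne : G ≠ φ ⊤)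
    {i j : Fin n} {s t : Bool} (hi : φ (coat i s) ≤ G) (hj : φ (coat j t) ≤ G) : i = j ∧ s = t := by
  obtain ⟨d, hd⟩ := h.surj (φ ⊤ ⊓ G)
    (fun e => h.ne_bot (coat i s) (le_bot_iff.1 (e ▸ le_inf (h.le_top _) hi))) inf_le_left
  have hdt : d ≠ ⊤ := by
    rintro rfl
    exact hne (h.coatom.eq_of_le_coatom hG (hd.le.trans inf_le_right)).symm
  have h1 : d = coat i s := eq_of_coat_le (by rw [← h.le_iff, hd]; exact le_inf (h.le_top _) hi) hdt
  have h2 : d = coat j t := eq_of_coat_le (by rw [← h.le_iff, hd]; exact le_inf (h.le_top _) hj) hdt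
  exact coat_inj.1 (h1.symm.trans h2)

theorem _root_.IsFrame.le_or_le_of_le (h : IsFrame φ) (hψ : IsFrame ψ) {i j l : Fin n}
    {s t w : Bool}
    (hlt : ψ (coat l w) ≤ φ ⊤) (hne : ψ ⊤ ≠ φ ⊤)
    (hr : φ (Function.update (coat i s) j (pt t)) ≤ ψ (coat l w)) :
    ψ (coat l w) ≤ φ (coat i s) ∨ ψ (coat l w) ≤ φ (coat j t) := by
  obtain ⟨f, hf⟩ := h.surj _ (hψ.ne_bot _) hlt
  rw [← hf, h.le_iff] at hr
  rw [← hf, h.le_iff, h.le_iff]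
  refine le_coat_or_le_coat hr ?_
  rintro rfl
  exact hne (h.coatom.eq_of_le_coatom hψ.coatom (hf.le.trans (hψ.le_top _))).symm

theorem mirror_coat_le (hL : IsFlat n L) (i : Fin n) (s : Bool)
    (φ : {φ : (Fin n → Seg) → L // IsFrame φ}) : φ.1 (coat i s) ≤ (hL.mirror i s φ).1 ⊤ := by
  rw [← hL.mirror_apply φ (coat_self i s)]
  exact (hL.mirror i s φ).2.le_top _

theorem mirror_top_ne_mirror_top (hL : IsFlat n L) {i j : Fin n} (hij : i ≠ j) (s t : Bool)
    (φ : {φ : (Fin n → Seg) → L // IsFrame φ}) :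
    (hL.mirror i s φ).1 ⊤ ≠ (hL.mirror j t φ).1 ⊤ := by
  intro e
  exact hij (IsFrame.coat_eq_of_le φ.2 (hL.mirror i s φ).2.coatom (hL.mirror_top_ne i s φ)
    (hL.mirror_coat_le i s φ) (e ▸ hL.mirror_coat_le j t φ)).1

theorem mirror_mirror_top_ne (hL : IsFlat n L) {i j : Fin n} (hij : i ≠ j) (s t : Bool)
    (φ : {φ : (Fin n → Seg) → L // IsFrame φ}) :
    (hL.mirror j t (hL.mirror i s φ)).1 ⊤ ≠ φ.1 ⊤ := by
  intro e
  have h := hL.mirror_top_ne_mirror_top hij s t (hL.mirror i s φ)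
  rw [hL.mirror_mirror] at h
  exact h e.symm

/-- The two facets adjacent to a given facet along a face of codimension two are not adjacent:
otherwise they would close up a cycle of three facets, and the fourth facet around the face would
be isolated. -/
theorem mirror_mirror_top_ne_mirror_top (hL : IsFlat n L) {i j : Fin n} (hij : i ≠ j) (s t : Bool)
    (φ : {φ : (Fin n → Seg) → L // IsFrame φ}) :
    (hL.mirror j t (hL.mirror i s φ)).1 ⊤ ≠ (hL.mirror j t φ).1 ⊤ := by
  intro e
  let c₀ : Fin n → Seg := Function.update (coat i s) j (pt t)
  have hc₀j : c₀ j = pt t := by simp [c₀]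
  have hc₀i : c₀ i = pt s := by simp [c₀, hij]
  let φ₁ := hL.mirror i s φ
  let φ₂ := hL.mirror j t φ
  have hr₁ : φ₁.1 c₀ = φ.1 c₀ := hL.mirror_apply φ hc₀i
  have hr₂ : φ₂.1 c₀ = φ.1 c₀ := hL.mirror_apply φ hc₀j
  have n1 : φ₁.1 ⊤ ≠ φ.1 ⊤ := hL.mirror_top_ne i s φ
  have n2 : φ₂.1 ⊤ ≠ φ.1 ⊤ := hL.mirror_top_ne j t φ
  have n12 : φ₁.1 ⊤ ≠ φ₂.1 ⊤ := hL.mirror_top_ne_mirror_top hij s t φ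
  have hb : φ₁.1 (coat j t) ≤ φ₂.1 ⊤ := by rw [← e]; exact hL.mirror_coat_le j t φ₁
  have hb' : ¬ φ₁.1 (coat j t) ≤ φ.1 ⊤ := fun h =>
    hij (IsFrame.coat_eq_of_le φ₁.2 φ.2.coatom n1.symm
      (by rw [hL.mirror_apply φ (coat_self i s)]; exact φ.2.le_top _) h).1
  have hc₀le : c₀ ≤ coat j t := le_coat.2 hc₀j
  -- the remaining face of codimension one of the facet `φ₂ ⊤` is shared with `φ₁ ⊤`
  have hb₂ : φ₁.1 (coat j t) ≤ φ₂.1 (coat i s) := by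
    refine (IsFrame.le_or_le_of_le φ₂.2 φ₁.2 hb n12 (i := i) (j := j) (s := s) (t := t)
      ?_).resolve_right ?_
    · rw [hr₂, ← hr₁, φ₁.2.le_iff]; exact hc₀le
    · intro h
      exact hb' (h.trans (by rw [hL.mirror_apply φ (coat_self j t)]; exact φ.2.le_top _))
  have ha₂ : φ₂.1 (coat i s) ≤ φ₁.1 ⊤ := by
    have h3 := hL.mirror_coat_le i s φ₂
    by_cases e' : (hL.mirror i s φ₂).1 ⊤ = φ₁.1 ⊤
    · exact e' ▸ h3
    · exact (hL.not_three φ₁.2 φ₁.2.coatom φ₂.2.coatom (hL.mirror i s φ₂).2.coatom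
        (φ₁.2.le_top _) hb (hb₂.trans h3) n12 (Ne.symm e') (hL.mirror_top_ne i s φ₂).symm).elim
  -- a fourth facet `H` around the face, and its neighbour `G` across one of its two walls there
  obtain ⟨H, ⟨hH, hrH⟩, hHn⟩ := Set.exists_mem_notMem_of_ncard_lt_ncard
    (s := {φ.1 ⊤, φ₁.1 ⊤, φ₂.1 ⊤}) (t := {F : L | IsCoatom F ∧ φ.1 c₀ ≤ F}) (by
      rw [hL.four φ.1 φ.2 i j s t hij]
      exact (Set.ncard_insert_le _ _).trans_lt (Nat.succ_lt_succ
        ((Set.ncard_insert_le _ _).trans_lt (by rw [Set.ncard_singleton]; norm_num))))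
  simp only [Set.mem_insert_iff, Set.mem_singleton_iff, not_or] at hHn
  obtain ⟨hH0, hH1, hH2⟩ := hHn
  obtain ⟨χ, hχ, rfl⟩ := hL.exists_frame H hH
  obtain ⟨d, hd⟩ := hχ.surj _ (φ.2.ne_bot _) hrH
  have hdt : d ≠ ⊤ := by
    rintro rfl
    exact hH0 (hχ.coatom.eq_of_le_coatom φ.2.coatom (hd ▸ φ.2.le_top _))
  obtain ⟨l, w, hl⟩ := exists_le_coat hdt
  have hrl : φ.1 c₀ ≤ χ (coat l w) := by rw [← hd, hχ.le_iff]; exact hl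
  obtain ⟨G, hG, hlG, hGH⟩ := hL.exists_other hχ l w
  have hlH := hχ.le_top (coat l w)
  have no : ∀ {A B : L}, IsCoatom A → IsCoatom B → χ (coat l w) ≤ A → χ (coat l w) ≤ B →
      A ≠ B → χ ⊤ ≠ A → χ ⊤ ≠ B → False := fun hA hB hA' hB' h1 h2 h3 =>
    hL.not_three hχ hχ.coatom hA hB hlH hA' hB' h2 h3 h1
  have hGmem : G = φ.1 ⊤ ∨ G = φ₁.1 ⊤ ∨ G = φ₂.1 ⊤ := by
    by_contra! hcon
    have h4 := hL.four φ.1 φ.2 i j s t hij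
    have hfin : {F : L | IsCoatom F ∧ φ.1 c₀ ≤ F}.Finite :=
      Set.finite_of_ncard_ne_zero (by rw [h4]; norm_num)
    have hs : ({G, χ ⊤, φ.1 ⊤, φ₁.1 ⊤, φ₂.1 ⊤} : Set L) ⊆ {F : L | IsCoatom F ∧ φ.1 c₀ ≤ F} := by
      rintro x (rfl | rfl | rfl | rfl | rfl)
      exacts [⟨hG, hrl.trans hlG⟩, ⟨hH, hrH⟩, ⟨φ.2.coatom, φ.2.le_top _⟩,
        ⟨φ₁.2.coatom, hr₁ ▸ φ₁.2.le_top _⟩, ⟨φ₂.2.coatom, hr₂ ▸ φ₂.2.le_top _⟩]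
    have h5 := Set.ncard_le_ncard hs hfin
    rw [h4, Set.ncard_insert_of_notMem (by simp [hGH, hcon]),
      Set.ncard_insert_of_notMem (by simp [hH0, hH1, hH2]),
      Set.ncard_eq_three.2 ⟨_, _, _, n1.symm, n2.symm, n12, rfl⟩] at h5
    omega
  -- `H` shares a wall with one of the three facets, but these walls are already shared by two of
  -- the three
  rcases hGmem with rfl | rfl | rfl
  · rcases IsFrame.le_or_le_of_le φ.2 hχ hlG hH0 hrl with h | h
    · exact no φ.2.coatom φ₁.2.coatom hlG (h.trans (hL.mirror_coat_le i s φ)) n1.symm hH0 hH1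
    · exact no φ.2.coatom φ₂.2.coatom hlG (h.trans (hL.mirror_coat_le j t φ)) n2.symm hH0 hH2
  · rcases IsFrame.le_or_le_of_le φ₁.2 hχ hlG hH1 (hr₁.le.trans hrl) with h | h
    · refine no φ.2.coatom φ₁.2.coatom (h.trans ?_) hlG n1.symm hH0 hH1
      rw [hL.mirror_apply φ (coat_self i s)]; exact φ.2.le_top _
    · exact no φ₁.2.coatom φ₂.2.coatom hlG (h.trans hb) n12 hH1 hH2
  · rcases IsFrame.le_or_le_of_le φ₂.2 hχ hlG hH2 (hr₂.le.trans hrl) with h | h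
    · exact no φ₁.2.coatom φ₂.2.coatom (h.trans ha₂) hlG n12 hH1 hH2
    · refine no φ.2.coatom φ₂.2.coatom (h.trans ?_) hlG n2.symm hH0 hH2
      rw [hL.mirror_apply φ (coat_self j t)]; exact φ.2.le_top _

/-- Going around a face of codimension two in both directions, one arrives at the same frame after
two steps. -/
theorem mirror_comm (hL : IsFlat n L) {i j : Fin n} (hij : i ≠ j) (s t : Bool)
    (φ : {φ : (Fin n → Seg) → L // IsFrame φ}) :
    hL.mirror j t (hL.mirror i s φ) = hL.mirror i s (hL.mirror j t φ) := by
  let c₀ : Fin n → Seg := Function.update (coat i s) j (pt t)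
  have hc₀j : c₀ j = pt t := by simp [c₀]
  have hc₀i : c₀ i = pt s := by simp [c₀, hij]
  let φ₁ := hL.mirror i s φ
  let φ₂ := hL.mirror j t φ
  let φ₁₂ := hL.mirror j t φ₁
  let φ₂₁ := hL.mirror i s φ₂
  have hr₁ : φ₁.1 c₀ = φ.1 c₀ := hL.mirror_apply φ hc₀i
  have hr₂ : φ₂.1 c₀ = φ.1 c₀ := hL.mirror_apply φ hc₀j
  have hr₁₂ : φ₁₂.1 c₀ = φ.1 c₀ := (hL.mirror_apply φ₁ hc₀j).trans hr₁
  have hr₂₁ : φ₂₁.1 c₀ = φ.1 c₀ := (hL.mirror_apply φ₂ hc₀i).trans hr₂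
  have n1 : φ₁.1 ⊤ ≠ φ.1 ⊤ := hL.mirror_top_ne i s φ
  have n2 : φ₂.1 ⊤ ≠ φ.1 ⊤ := hL.mirror_top_ne j t φ
  have n12 : φ₁.1 ⊤ ≠ φ₂.1 ⊤ := hL.mirror_top_ne_mirror_top hij s t φ
  have m0 : φ₁₂.1 ⊤ ≠ φ.1 ⊤ := hL.mirror_mirror_top_ne hij s t φ
  have m1 : φ₁₂.1 ⊤ ≠ φ₁.1 ⊤ := hL.mirror_top_ne j t φ₁
  have m2 : φ₁₂.1 ⊤ ≠ φ₂.1 ⊤ := hL.mirror_mirror_top_ne_mirror_top hij s t φ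
  have k0 : φ₂₁.1 ⊤ ≠ φ.1 ⊤ := hL.mirror_mirror_top_ne hij.symm t s φ
  have k2 : φ₂₁.1 ⊤ ≠ φ₂.1 ⊤ := hL.mirror_top_ne i s φ₂
  have k1 : φ₂₁.1 ⊤ ≠ φ₁.1 ⊤ := hL.mirror_mirror_top_ne_mirror_top hij.symm t s φ
  -- otherwise there are five facets around the face
  have ht : φ₁₂.1 ⊤ = φ₂₁.1 ⊤ := by
    by_contra hcon
    have h4 := hL.four φ.1 φ.2 i j s t hij
    have hfin : {F : L | IsCoatom F ∧ φ.1 c₀ ≤ F}.Finite :=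
      Set.finite_of_ncard_ne_zero (by rw [h4]; norm_num)
    have hs : ({φ₁₂.1 ⊤, φ₂₁.1 ⊤, φ.1 ⊤, φ₁.1 ⊤, φ₂.1 ⊤} : Set L) ⊆
        {F : L | IsCoatom F ∧ φ.1 c₀ ≤ F} := by
      rintro x (rfl | rfl | rfl | rfl | rfl)
      exacts [⟨φ₁₂.2.coatom, hr₁₂ ▸ φ₁₂.2.le_top _⟩, ⟨φ₂₁.2.coatom, hr₂₁ ▸ φ₂₁.2.le_top _⟩,
        ⟨φ.2.coatom, φ.2.le_top _⟩,
        ⟨φ₁.2.coatom, hr₁ ▸ φ₁.2.le_top _⟩, ⟨φ₂.2.coatom, hr₂ ▸ φ₂.2.le_top _⟩]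
    have h5 := Set.ncard_le_ncard hs hfin
    rw [h4, Set.ncard_insert_of_notMem (by simp [hcon, m0, m1, m2]),
      Set.ncard_insert_of_notMem (by simp [k0, k1, k2]),
      Set.ncard_eq_three.2 ⟨_, _, _, n1.symm, n2.symm, n12, rfl⟩] at h5
    omega
  have ha : φ₂₁.1 (coat i s) = φ₂.1 (coat i s) := hL.mirror_apply φ₂ (coat_self i s)
  have hb : φ₁₂.1 (coat j t) = φ₁.1 (coat j t) := hL.mirror_apply φ₁ (coat_self j t)
  -- the corresponding faces of codimension one of the two frames agree
  have key : ∀ (c : Fin n → Seg) (l : Fin n) (w : Bool), φ₂₁.1 c = φ₁₂.1 c → ∀ k u, c ≤ coat k u →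
      φ₂₁.1 (coat k u) = φ₁₂.1 (coat l w) → c ≤ coat l w := by
    intro c l w hc k u hk e
    rw [← φ₁₂.2.le_iff, ← hc, ← e, φ₂₁.2.le_iff]; exact hk
  have hcc : ∀ c : Fin n → Seg, c i = pt s → c j = pt t → φ₂₁.1 c = φ₁₂.1 c := by
    intro c hci hcj
    rw [hL.mirror_apply φ₂ hci, hL.mirror_apply φ hcj, hL.mirror_apply φ₁ hcj,
      hL.mirror_apply φ hci]
  have hi : φ₂₁.1 (coat i s) = φ₁₂.1 (coat i s) := by
    obtain ⟨l, w, hl⟩ := φ₂₁.2.exists_coat φ₁₂.2 ht.symm i s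
    have h1 := key c₀ l w (hcc c₀ hc₀i hc₀j) i s (le_coat.2 hc₀i) hl
    rcases le_coat_or_le_coat h1 (coat_ne_top _ _) with h2 | h2
    · rw [hl, eq_of_coat_le h2 (coat_ne_top _ _)]
    · exfalso
      rw [← eq_of_coat_le h2 (coat_ne_top _ _), hb, ha] at hl
      refine hL.not_three φ₁.2 φ₁.2.coatom φ₂.2.coatom φ₁₂.2.coatom (φ₁.2.le_top (coat j t))
        ?_ ?_ n12 m1.symm m2.symm
      · rw [← hl]; exact φ₂.2.le_top _
      · rw [← hb]; exact φ₁₂.2.le_top _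
  have hj : φ₂₁.1 (coat j t) = φ₁₂.1 (coat j t) := by
    obtain ⟨l, w, hl⟩ := φ₂₁.2.exists_coat φ₁₂.2 ht.symm j t
    have h1 := key c₀ l w (hcc c₀ hc₀i hc₀j) j t (le_coat.2 hc₀j) hl
    rcases le_coat_or_le_coat h1 (coat_ne_top _ _) with h2 | h2
    · rw [← eq_of_coat_le h2 (coat_ne_top _ _), ← hi] at hl
      exact absurd (coat_inj.1 (φ₂₁.2.inj hl)).1.symm hij
    · rw [hl, eq_of_coat_le h2 (coat_ne_top _ _)]
  refine Subtype.ext (φ₂₁.2.ext_coat φ₁₂.2 ht.symm fun k u => ?_).symm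
  have opp : ∀ {k : Fin n} {u v : Bool}, φ₂₁.1 (coat k v) = φ₁₂.1 (coat k v) →
      φ₂₁.1 (coat k u) = φ₁₂.1 (coat k u) := by
    intro k u v h
    by_cases e : u = v
    · exact e ▸ h
    · have : u = !v := by cases u <;> cases v <;> simp_all
      exact this ▸ φ₂₁.2.coat_opposite φ₁₂.2 ht.symm h
  by_cases hki : k = i
  · subst hki; exact opp hi
  by_cases hkj : k = j
  · subst hkj; exact opp hj
  obtain ⟨l, w, hl⟩ := φ₂₁.2.exists_coat φ₁₂.2 ht.symm k u
  let c : Fin n → Seg := Function.update c₀ k (pt u)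
  have hci : c i = pt s := by simp [c, Ne.symm hki, hc₀i]
  have hcj : c j = pt t := by simp [c, Ne.symm hkj, hc₀j]
  have h1 := le_coat.1 (key c l w (hcc c hci hcj) k u (le_coat.2 (by simp [c])) hl)
  by_cases hli : l = i
  · subst hli
    rw [hci] at h1; cases h1
    exact absurd (coat_inj.1 (φ₂₁.2.inj (hl.trans hi.symm))).1 hki
  by_cases hlj : l = j
  · subst hlj
    rw [hcj] at h1; cases h1
    exact absurd (coat_inj.1 (φ₂₁.2.inj (hl.trans hj.symm))).1 hkj
  by_cases hlk : l = k
  · subst hlk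
    simp [c] at h1
    rw [hl, h1]
  · simp [c, c₀, hlk, hlj, coat_of_ne s hli] at h1

end IsFlat

end

section

open Seg

/-! ### Frames of a closed cubical complex -/

/-- The non-empty intervals of the Boolean lattice of subsets of a `k`-element set are the faces of
the `k`-cube. -/
def intervalEquiv (k : ℕ) : NonemptyInterval (Fin k → Bool) ≃o (Fin k → Seg) where
  toFun I i := if I.fst i = I.snd i then pt (I.fst i) else all
  invFun c := ⟨(fun i => if c i = pt true then true else false,
      fun i => if c i = pt false then false else true), fun i => by
    rcases h : c i with s | _
    · cases s <;> simp [h]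
    · simp [h]⟩
  left_inv I := by
    ext i
    · have := I.fst_le_snd i
      revert this
      cases h1 : I.fst i <;> cases h2 : I.snd i <;> simp_all
    · have := I.fst_le_snd i
      revert this
      cases h1 : I.fst i <;> cases h2 : I.snd i <;> simp_all
  right_inv c := by
    funext i
    rcases h : c i with s | _
    · cases s <;> simp [h]
    · simp [h]
  map_rel_iff' := by
    intro I J
    rw [NonemptyInterval.le_def, Pi.le_def, Pi.le_def, Pi.le_def, ← forall_and]
    refine forall_congr' fun i => ?_
    have hI := I.fst_le_snd i
    have hJ := J.fst_le_snd i
    revert hI hJ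
    simp only [Equiv.coe_fn_mk]
    cases I.fst i <;> cases I.snd i <;> cases J.fst i <;> cases J.snd i <;>
      simp [Seg.le_def]

variable {n : ℕ} {L : Type*} [Lattice L] [BoundedOrder L]

theorem isCubeFace_of_frame {k : ℕ} (ψ : (Fin k → Seg) → L) (hle : ∀ c d, ψ c ≤ ψ d ↔ c ≤ d)
    (hbot : ∀ c, ψ c ≠ ⊥) (hs : ∀ x, x ≠ ⊥ → x ≤ ψ ⊤ → ∃ c, ψ c = x) : IsCubeFace k (ψ ⊤) := by
  let f : Interval (Fin k → Bool) → Set.Iic (ψ ⊤) := fun I =>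
    match I with
    | none => ⟨⊥, bot_le⟩
    | some I => ⟨ψ (intervalEquiv k I), (hle _ _).2 le_top⟩
  have hf : ∀ I J, f I ≤ f J ↔ I ≤ J := by
    rintro (_ | I) (_ | J)
    · exact iff_of_true le_rfl le_rfl
    · exact iff_of_true bot_le bot_le
    · exact iff_of_false (fun h => hbot _ (le_bot_iff.1 h))
        (fun h => WithBot.not_coe_le_bot I h)
    · refine Iff.trans ?_ (WithBot.coe_le_coe.symm)
      exact (hle _ _).trans (intervalEquiv k).le_iff_le
  refine ⟨(OrderIso.ofSurjective (OrderEmbedding.ofMapLEIff f hf) ?_).symm⟩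
  rintro ⟨x, hx⟩
  by_cases h : x = ⊥
  · subst h; exact ⟨none, rfl⟩
  · obtain ⟨c, rfl⟩ := hs x h hx
    exact ⟨some ((intervalEquiv k).symm c), Subtype.ext (congrArg ψ (by simp))⟩

theorem exists_frame_of_isCubeFace {F : L} (hF : IsCoatom F) (h : IsCubeFace n F) :
    ∃ φ : (Fin n → Seg) → L, IsFrame φ ∧ φ ⊤ = F := by
  obtain ⟨e⟩ := h
  let φ : (Fin n → Seg) → L := fun c => (e.symm ((intervalEquiv n).symm c : NonemptyInterval _)).1
  have hs : ∀ x, x ≠ ⊥ → x ≤ F → ∃ c, φ c = x := by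
    intro x hx hxF
    have : e ⟨x, hxF⟩ ≠ ⊥ := fun h => hx (by
      have := (map_eq_bot_iff e).1 h
      simpa using congrArg Subtype.val this)
    rcases hI : e ⟨x, hxF⟩ with _ | I
    · exact (this hI).elim
    · refine ⟨intervalEquiv n I, ?_⟩
      have h1 : e.symm (some I) = ⟨x, hxF⟩ := by rw [← hI]; simp
      simp only [φ, OrderIso.symm_apply_apply]
      exact congrArg Subtype.val h1
  have hle : ∀ {c d}, φ c ≤ φ d ↔ c ≤ d := by
    intro c d
    simp only [φ, Subtype.coe_le_coe, OrderIso.le_iff_le]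
    exact WithBot.coe_le_coe.trans (OrderIso.le_iff_le _)
  have hb : ∀ c, φ c ≠ ⊥ := by
    intro c h
    have h1 : e.symm ((intervalEquiv n).symm c : NonemptyInterval _) = ⊥ := Subtype.ext h
    exact WithBot.coe_ne_bot ((map_eq_bot_iff e.symm).1 h1)
  have ht : φ ⊤ = F := by
    have hFb : F ≠ ⊥ := fun h => hb ⊤ (le_bot_iff.1 ((Subtype.prop (e.symm _)).trans h.le))
    obtain ⟨c, hc⟩ := hs F hFb le_rfl
    refine le_antisymm (Subtype.prop (e.symm _)) ?_
    rw [← hc]; exact hle.2 le_top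
  exact ⟨φ, ⟨ht ▸ hF, hle, hb, fun x h h' => hs x h (ht ▸ h')⟩, ht⟩

theorem isCubeFace_coat {k : ℕ} {φ : (Fin (k + 1) → Seg) → L} (h : IsFrame φ) (i : Fin (k + 1))
    (s : Bool) : IsCubeFace k (φ (coat i s)) := by
  have e : i.insertNth (pt s) (⊤ : Fin k → Seg) = coat i s := by
    funext j
    rcases Fin.eq_self_or_eq_succAbove i j with rfl | ⟨j, rfl⟩
    · simp
    · rw [coat_of_ne s (Fin.succAbove_ne i j)]; simp [top_eq]
  rw [← e]
  refine isCubeFace_of_frame (fun c => φ (i.insertNth (pt s) c)) (fun c d => ?_)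
    (fun c => h.ne_bot _) fun x hx hx' => ?_
  · rw [h.le_iff]; simp [Fin.insertNth_le_iff]
  · obtain ⟨c, rfl⟩ := h.surj x hx (hx'.trans (h.le_top _))
    have hc := le_coat.1 (h.le_iff.1 (e ▸ hx'))
    refine ⟨i.removeNth c, ?_⟩
    simp only [← hc, Fin.insertNth_self_removeNth]

theorem isCubeFace_codim_two {k : ℕ} {φ : (Fin (k + 2) → Seg) → L} (h : IsFrame φ)
    {i j : Fin (k + 2)} (s t : Bool) (hij : i ≠ j) :
    IsCubeFace k (φ (Function.update (coat i s) j (pt t))) := by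
  obtain ⟨j', rfl⟩ := (Fin.exists_succAbove_eq hij : ∃ i', j.succAbove i' = i)
  have e : j.insertNth (pt t) (j'.insertNth (pt s) (⊤ : Fin k → Seg)) =
      Function.update (coat (j.succAbove j') s) j (pt t) := by
    funext l
    rcases Fin.eq_self_or_eq_succAbove j l with rfl | ⟨l, rfl⟩
    · simp
    · rcases Fin.eq_self_or_eq_succAbove j' l with rfl | ⟨l, rfl⟩
      · simp
      · simp [top_eq, coat]
  rw [← e]
  refine isCubeFace_of_frame (fun c => φ (j.insertNth (pt t) (j'.insertNth (pt s) c)))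
    (fun c d => ?_) (fun c => h.ne_bot _) fun x hx hx' => ?_
  · rw [h.le_iff]; simp [Fin.insertNth_le_iff]
  · obtain ⟨c, rfl⟩ := h.surj x hx (hx'.trans (h.le_top _))
    have hc := h.le_iff.1 hx'
    have hj : c j = pt t := by simpa using hc j
    have hi : j.removeNth c j' = pt s := by
      simpa [Fin.removeNth] using hc (j.succAbove j')
    refine ⟨j'.removeNth (j.removeNth c), ?_⟩
    rw [← hi, Fin.insertNth_self_removeNth, ← hj, Fin.insertNth_self_removeNth]

theorem isFlat_of_four (hn : 2 ≤ n) (hL : IsClosedCubicalComplex n L)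
    (h4 : ∀ x : L, IsCubeFace (n - 2) x → {F : L | IsCoatom F ∧ x ≤ F}.ncard = 4) :
    IsFlat n L where
  exists_frame F hF := exists_frame_of_isCubeFace hF (hL.facet_cube F hF)
  two φ h i s := by
    obtain ⟨k, rfl⟩ := Nat.exists_eq_add_of_le' hn
    exact hL.closed (k + 1) rfl _ (isCubeFace_coat h i s)
  four φ h i j s t hij := by
    obtain ⟨k, rfl⟩ := Nat.exists_eq_add_of_le' hn
    exact h4 _ (isCubeFace_codim_two h s t hij)

end

section

open Seg

/-! ### Faces of the cubical lattice in coordinates -/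

/-- The faces of the tessellation of the real line by unit segments, in the coordinates of the
Khalimsky line: `⟨2 * k⟩` is the point `k` and `⟨2 * k + 1⟩` is the segment `[k, k + 1]`. The faces
of the cubical lattice are the functions `Fin n → Cell`. -/
@[ext] structure Cell where
  z : ℤ

namespace Cell

instance : PartialOrder Cell where
  le a b := a = b ∨ b.z % 2 = 1 ∧ (a.z = b.z - 1 ∨ a.z = b.z + 1)
  le_refl a := Or.inl rfl
  le_trans := by
    rintro a b c (rfl | h) (rfl | h')
    · exact Or.inl rfl
    · exact Or.inr h'
    · exact Or.inr h
    · omega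
  le_antisymm := by
    rintro a b (rfl | h) (h' | h')
    · rfl
    · rfl
    · exact h'.symm
    · omega

theorem le_iff {a b : Cell} :
    a ≤ b ↔ a.z = b.z ∨ b.z % 2 = 1 ∧ (a.z = b.z - 1 ∨ a.z = b.z + 1) := by
  rw [← Cell.ext_iff]; rfl

end Cell

/-- The position of a face of the unit segment in the coordinates of `Cell`. -/
def Seg.val : Seg → ℤ
  | pt false => 0
  | pt true => 2
  | all => 1

variable {n : ℕ}

/-- The unit cube of the cubical lattice with smallest vertex `k`. -/
def cube (k : Fin n → ℤ) : Fin n → Cell := fun i => ⟨2 * k i + 1⟩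

/-- The identification of the standard cube with `cube k` by translation. -/
def cubeMap (k : Fin n → ℤ) (c : Fin n → Seg) : Fin n → Cell := fun i => ⟨2 * k i + (c i).val⟩

@[simp] theorem cubeMap_top (k : Fin n → ℤ) : cubeMap k ⊤ = cube k := rfl

theorem cubeMap_le_iff {k : Fin n → ℤ} {c d : Fin n → Seg} : cubeMap k c ≤ cubeMap k d ↔ c ≤ d := by
  rw [Pi.le_def, Pi.le_def]
  refine forall_congr' fun i => ?_
  simp only [cubeMap, Cell.le_iff, Seg.le_def]
  rcases c i with (_ | _) | _ <;> rcases d i with (_ | _) | _ <;> (simp [Seg.val]; try omega)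

theorem le_cube_iff {k : Fin n → ℤ} {c : Fin n → Cell} :
    c ≤ cube k ↔ ∀ i, (c i).z = 2 * k i ∨ (c i).z = 2 * k i + 1 ∨ (c i).z = 2 * k i + 2 := by
  rw [Pi.le_def]
  refine forall_congr' fun i => ?_
  simp only [cube, Cell.le_iff]
  omega

theorem cubeMap_le_cube (k : Fin n → ℤ) (c : Fin n → Seg) : cubeMap k c ≤ cube k :=
  cubeMap_le_iff.2 le_top

theorem exists_cubeMap {k : Fin n → ℤ} {c : Fin n → Cell} (h : c ≤ cube k) :
    ∃ d, cubeMap k d = c := by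
  rw [le_cube_iff] at h
  refine ⟨fun i => if (c i).z = 2 * k i then pt false else
    if (c i).z = 2 * k i + 2 then pt true else all, ?_⟩
  funext i
  ext
  have := h i
  simp only [cubeMap]
  split_ifs with h1 h2 <;> simp [Seg.val] <;> omega

/-- A property of points of `ℤ ^ n` holds everywhere if it holds at one point and is invariant under
unit steps. -/
theorem Int.pi_induction {P : (Fin n → ℤ) → Prop} (k₀ : Fin n → ℤ) (h₀ : P k₀)
    (h : ∀ k i, P k ↔ P (Function.update k i (k i + 1))) (k : Fin n → ℤ) : P k := by
  have step : ∀ (k : Fin n → ℤ) i z, P k ↔ P (Function.update k i z) := by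
    intro k i z
    have h1 : ∀ w, P (Function.update k i w) ↔ P (Function.update k i (w + 1)) := fun w => by
      simpa using h (Function.update k i w) i
    have h2 : ∀ w : ℤ, P k ↔ P (Function.update k i (k i + w)) := by
      intro w
      induction w using Int.induction_on with
      | zero => simp
      | succ j ih => rw [ih, h1, add_assoc]
      | pred j ih => rw [ih, h1 (k i + (-j - 1)), show k i + (-(j : ℤ) - 1) + 1 = k i + -j by ring]
    simpa using h2 (z - k i)
  have key : ∀ S : Finset (Fin n), P (fun j => if j ∈ S then k j else k₀ j) := by
    intro S
    induction S using Finset.induction_on with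
    | empty => simpa using h₀
    | insert i S hi ih =>
      rw [step _ i (k i)] at ih
      convert ih using 1
      funext j
      by_cases e : j = i
      · subst e; simp
      · simp [e]
  simpa using key Finset.univ

/-! ### Symmetries of the cubical lattice in coordinates -/

/-- The symmetry `x ↦ (ε i * x (σ i) + t i)` of the cubical lattice, acting on the faces. -/
def cellSymm (σ : Equiv.Perm (Fin n)) (ε : Fin n → ℤˣ) (t : Fin n → ℤ) (c : Fin n → Cell) :
    Fin n → Cell := fun i => ⟨(ε i : ℤ) * (c (σ i)).z + 2 * t i⟩

theorem cellSymm_le_iff (σ : Equiv.Perm (Fin n)) (ε : Fin n → ℤˣ) (t : Fin n → ℤ)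
    {c d : Fin n → Cell} : cellSymm σ ε t c ≤ cellSymm σ ε t d ↔ c ≤ d := by
  have : ∀ i, cellSymm σ ε t c i ≤ cellSymm σ ε t d i ↔ c (σ i) ≤ d (σ i) := by
    intro i
    simp only [cellSymm, Cell.le_iff]
    rcases Int.units_eq_one_or (ε i) with e | e <;> simp only [e] <;> push_cast <;> omega
  rw [Pi.le_def, Pi.le_def]
  simp only [this]
  exact ⟨fun h i => by simpa using h (σ.symm i), fun h i => h _⟩

/-- The index of the cube that is the image of `cube k` under a symmetry. -/
def indexSymm (σ : Equiv.Perm (Fin n)) (ε : Fin n → ℤˣ) (t : Fin n → ℤ) (k : Fin n → ℤ) :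
    Fin n → ℤ := fun i => if ε i = 1 then k (σ i) + t i else - k (σ i) - 1 + t i

theorem cellSymm_cubeMap (σ : Equiv.Perm (Fin n)) (ε : Fin n → ℤˣ) (t : Fin n → ℤ) (k : Fin n → ℤ)
    (c : Fin n → Seg) : cellSymm σ ε t (cubeMap k c) =
      cubeMap (indexSymm σ ε t k) (signedPerm σ (fun i => decide (ε i = -1)) c) := by
  funext i
  ext
  simp only [cellSymm, cubeMap, indexSymm, signedPerm_apply]
  rcases Int.units_eq_one_or (ε i) with e | e <;>
    rcases c (σ i) with (_ | _) | _ <;> simp [e, Seg.reflect, Seg.val] <;> ring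

theorem cellSymm_cube (σ : Equiv.Perm (Fin n)) (ε : Fin n → ℤˣ) (t : Fin n → ℤ) (k : Fin n → ℤ) :
    cellSymm σ ε t (cube k) = cube (indexSymm σ ε t k) := by
  rw [← cubeMap_top, cellSymm_cubeMap, map_top, cubeMap_top]

/-! ### Developing maps -/

variable {L : Type*} [Lattice L] [BoundedOrder L]

/-- A developing map of the complex `L`: it maps the faces of the cubical lattice to faces of `L`,
identifies each cube with a facet, and maps adjacent cubes to different facets. -/
structure IsDeveloping (p : (Fin n → Cell) → L) : Prop where
  frame : ∀ k, IsFrame fun c => p (cubeMap k c)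
  adj : ∀ k i, p (cube (Function.update k i (k i + 1))) ≠ p (cube k)

/-- The reflection of the `i`-th coordinate of the standard cube. -/
def reflectAt (i : Fin n) : (Fin n → Seg) ≃o (Fin n → Seg) :=
  signedPerm 1 (Function.update (fun _ => false) i true)

theorem reflectAt_apply (i : Fin n) (c : Fin n → Seg) :
    reflectAt i c = Function.update c i (reflect true (c i)) := by
  funext j
  by_cases e : j = i
  · subst e; simp [reflectAt]
  · simp only [reflectAt, signedPerm_apply, ne_eq, e, not_false_eq_true, Function.update_of_ne,
      Equiv.Perm.coe_one, id]
    cases c j <;> simp [reflect]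

theorem reflectAt_reflectAt (i : Fin n) (c : Fin n → Seg) : reflectAt i (reflectAt i c) = c := by
  simp [reflectAt_apply]

/-- Adjacent cubes, reflected into each other, agree on their common face. -/
theorem cubeMap_update (k : Fin n → ℤ) {i : Fin n} {c : Fin n → Seg} (h : c i = pt true) :
    cubeMap (Function.update k i (k i + 1)) (reflectAt i c) = cubeMap k c := by
  funext j
  ext
  by_cases e : j = i
  · subst e; simp [cubeMap, reflectAt_apply, h, reflect, Seg.val]; ring
  · simp [cubeMap, reflectAt_apply, e]

namespace IsDeveloping

variable {p q : (Fin n → Cell) → L}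

/-- If two developing maps agree on a cube, then they agree on the adjacent cubes, because reflected
frames are unique. -/
theorem agree_step (hL : IsFlat n L) (hp : IsDeveloping p) (hq : IsDeveloping q) (k : Fin n → ℤ)
    (i : Fin n) : (∀ c, p (cubeMap k c) = q (cubeMap k c)) ↔
      ∀ c, p (cubeMap (Function.update k i (k i + 1)) c) =
        q (cubeMap (Function.update k i (k i + 1)) c) := by
  constructor
  · intro h
    have key := hL.neighbor_unique (hp.frame k) (i := i) (s := true)
      ((hp.frame (Function.update k i (k i + 1))).comp (reflectAt i))
      ((hq.frame (Function.update k i (k i + 1))).comp (reflectAt i))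
      (by simpa using hp.adj k i) (by
        simp only [Function.comp_apply, map_top]
        rw [h ⊤]
        simpa using hq.adj k i)
      (fun c hc => by simp only [Function.comp_apply]; rw [cubeMap_update k hc])
      (fun c hc => by simp only [Function.comp_apply]; rw [cubeMap_update k hc, h])
    intro c
    simpa [reflectAt_reflectAt] using congrFun key (reflectAt i c)
  · intro h
    have e : ∀ c : Fin n → Seg, c i = pt false →
        cubeMap k (reflectAt i c) = cubeMap (Function.update k i (k i + 1)) c := by
      intro c hc
      have h' : reflectAt i c i = pt true := by simp [reflectAt_apply, hc, reflect]
      rw [← cubeMap_update k h', reflectAt_reflectAt]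
    have key := hL.neighbor_unique (hp.frame (Function.update k i (k i + 1))) (i := i) (s := false)
      ((hp.frame k).comp (reflectAt i)) ((hq.frame k).comp (reflectAt i))
      (by simpa using (hp.adj k i).symm) (by
        simp only [Function.comp_apply, map_top]
        rw [h ⊤]
        simpa using (hq.adj k i).symm)
      (fun c hc => by simp only [Function.comp_apply]; rw [e c hc])
      (fun c hc => by simp only [Function.comp_apply]; rw [e c hc, h])
    intro c
    simpa [reflectAt_reflectAt] using congrFun key (reflectAt i c)

theorem exists_le_cube (c : Fin n → Cell) : ∃ k, c ≤ cube k :=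
  ⟨fun i => (c i).z / 2, le_cube_iff.2 fun i => by omega⟩

/-- A developing map is determined by its values on the faces of one cube. -/
theorem eq_of_agree (hL : IsFlat n L) (hp : IsDeveloping p) (hq : IsDeveloping q) (k : Fin n → ℤ)
    (h : ∀ c, p (cubeMap k c) = q (cubeMap k c)) : p = q := by
  have key := Int.pi_induction (P := fun k => ∀ c, p (cubeMap k c) = q (cubeMap k c)) k h
    (agree_step hL hp hq)
  funext c
  obtain ⟨k, hk⟩ := exists_le_cube c
  obtain ⟨d, rfl⟩ := exists_cubeMap hk
  exact key k d

theorem comp_cellSymm (hp : IsDeveloping p) (σ : Equiv.Perm (Fin n)) (ε : Fin n → ℤˣ)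
    (t : Fin n → ℤ) : IsDeveloping (p ∘ cellSymm σ ε t) where
  frame k := by
    simp only [Function.comp_apply, cellSymm_cubeMap]
    exact (hp.frame (indexSymm σ ε t k)).comp _
  adj k i := by
    simp only [Function.comp_apply, cellSymm_cube]
    have hne : ∀ j, j ≠ σ.symm i → σ j ≠ i := fun j hj h => hj (by rw [← h]; simp)
    rcases Int.units_eq_one_or (ε (σ.symm i)) with e | e
    · have h := hp.adj (indexSymm σ ε t k) (σ.symm i)
      convert h using 3
      funext j
      by_cases hj : j = σ.symm i
      · subst hj; simp [indexSymm, e]; ring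
      · simp [indexSymm, hj, hne j hj]
    · have h := hp.adj (indexSymm σ ε t (Function.update k i (k i + 1))) (σ.symm i)
      refine fun h' => h ?_
      rw [h']
      congr 2
      funext j
      by_cases hj : j = σ.symm i
      · subst hj; simp [indexSymm, e]; ring
      · simp [indexSymm, hj, hne j hj]

end IsDeveloping

/-! ### Existence of the developing map -/

/-- The map that folds the line onto the unit segment: consecutive segments are mapped to it with
opposite orientations. -/
def foldCell (a : Cell) : Seg :=
  if a.z % 4 = 0 then pt false else if a.z % 4 = 2 then pt true else all

theorem foldCell_val (k : ℤ) (x : Seg) :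
    foldCell ⟨2 * k + x.val⟩ = reflect (decide (k % 2 = 1)) x := by
  rw [foldCell]
  rcases Int.emod_two_eq_zero_or_one k with e | e <;> rcases x with (_ | _) | _ <;>
    simp only [e, reflect, Seg.val, zero_ne_one, decide_false, decide_true, Bool.xor_false,
      Bool.xor_true, Bool.not_false, Bool.not_true]
  · exact if_pos (by omega)
  · exact (if_neg (by omega)).trans (if_pos (by omega))
  · exact (if_neg (by omega)).trans (if_neg (by omega))
  · exact (if_neg (by omega)).trans (if_pos (by omega))
  · exact if_pos (by omega)
  · exact (if_neg (by omega)).trans (if_neg (by omega))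

theorem foldCell_cubeMap (k : Fin n → ℤ) (c : Fin n → Seg) :
    (fun i => foldCell (cubeMap k c i)) = signedPerm 1 (fun i => decide (k i % 2 = 1)) c := by
  funext i
  exact foldCell_val (k i) (c i)

namespace IsFlat

/-- Moving a frame to the adjacent facet in the positive `i`-th direction. The frames of adjacent
facets are reflected, so that the positive direction is the side `q i` of the frame; the side
changes with each step. -/
noncomputable def shift (hL : IsFlat n L) (i : Fin n) :
    Equiv.Perm ({φ : (Fin n → Seg) → L // IsFrame φ} × (Fin n → Bool)) where
  toFun x := (hL.mirror i (x.2 i) x.1, Function.update x.2 i (!x.2 i))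
  invFun x := (hL.mirror i (!x.2 i) x.1, Function.update x.2 i (!x.2 i))
  left_inv x := by simp [mirror_mirror]
  right_inv x := by simp [mirror_mirror]

theorem shift_commute (hL : IsFlat n L) {i j : Fin n} (h : i ≠ j) :
    Commute (hL.shift i) (hL.shift j) := by
  refine Equiv.ext fun x => ?_
  simp only [Equiv.Perm.mul_apply, shift, Equiv.coe_fn_mk, ne_eq, h, h.symm, not_false_eq_true,
    Function.update_of_ne]
  rw [hL.mirror_comm h, Function.update_comm h]

/-- A family of frames indexed by the cubes of the cubical lattice, such that adjacent frames are
reflections of each other. It exists since the shifts commute, so that `ℤ ^ n` acts by them. -/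
theorem exists_family (hL : IsFlat n L) (φ : {φ : (Fin n → Seg) → L // IsFrame φ}) :
    ∃ Φ : (Fin n → ℤ) → {φ : (Fin n → Seg) → L // IsFrame φ},
      ∀ k i, Φ (Function.update k i (k i + 1)) = hL.mirror i (decide (k i % 2 = 0)) (Φ k) := by
  let T : (Fin n → Multiplicative ℤ) →* _ := MonoidHom.noncommPiCoprod
    (fun i => zpowersHom _ (hL.shift i)) (fun i j hij x y => by
      simpa using ((hL.shift_commute hij).zpow_zpow _ _))
  let X : (Fin n → ℤ) → _ := fun k => T (fun i => Multiplicative.ofAdd (k i)) (φ, fun _ => true)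
  have hX : ∀ k i, X (Function.update k i (k i + 1)) = hL.shift i (X k) := by
    intro k i
    have h1 : (fun j => Multiplicative.ofAdd (Function.update k i (k i + 1) j)) =
        Pi.mulSingle i (Multiplicative.ofAdd 1) * fun j => Multiplicative.ofAdd (k j) := by
      funext j
      by_cases e : j = i
      · subst e; simp [← ofAdd_add, add_comm]
      · simp [e]
    have h3 : T (Pi.mulSingle i (Multiplicative.ofAdd 1)) = hL.shift i :=
      (MonoidHom.noncommPiCoprod_mulSingle _ _ _).trans (by simp)
    simp only [X, h1, map_mul, Equiv.Perm.mul_apply, h3]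
  have h0 : X 0 = (φ, fun _ => true) := by
    have : (fun i : Fin n => Multiplicative.ofAdd ((0 : Fin n → ℤ) i)) = 1 := rfl
    simp only [X, this, map_one, Equiv.Perm.one_apply]
  have h2 : ∀ k, (X k).2 = fun i => decide (k i % 2 = 0) := by
    refine Int.pi_induction 0 (by rw [h0]; simp) fun k i => ?_
    rw [hX]
    have : (fun j => decide (Function.update k i (k i + 1) j % 2 = 0)) =
        Function.update (fun j => decide (k j % 2 = 0)) i (!decide (k i % 2 = 0)) := by
      funext j
      by_cases e : j = i
      · subst e
        simp only [Function.update_self]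
        rcases Int.emod_two_eq_zero_or_one (k j) with e | e <;> simp [e] <;> omega
      · simp [e]
    rw [this]
    simp only [shift, Equiv.coe_fn_mk]
    constructor
    · intro h; simp [h]
    · intro h
      funext j
      have h' := congrFun h j
      by_cases e : j = i
      · subst e; simpa using h'
      · simpa [e] using h'
  refine ⟨fun k => (X k).1, fun k i => ?_⟩
  simp only [hX, shift, Equiv.coe_fn_mk, h2]

/-- A complex with a frame has a developing map: on each cube it is the folding of the lattice onto
the standard cube, followed by the frame of that cube. -/
theorem exists_developing (hL : IsFlat n L) {φ : (Fin n → Seg) → L} (hφ : IsFrame φ) :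
    ∃ p : (Fin n → Cell) → L, IsDeveloping p := by
  obtain ⟨Φ, hΦ⟩ := hL.exists_family ⟨φ, hφ⟩
  let p : (Fin n → Cell) → L := fun c => (Φ fun i => (c i).z / 2).1 fun i => foldCell (c i)
  -- two cubes that contain `c` are joined by reflections across faces that contain `c`
  have key : ∀ k c, c ≤ cube k → (Φ k).1 (fun i => foldCell (c i)) = p c := by
    intro k c hc
    rw [le_cube_iff] at hc
    have h : ∀ S : Finset (Fin n), (Φ k).1 (fun i => foldCell (c i)) =
        (Φ fun j => if j ∈ S then (c j).z / 2 else k j).1 (fun i => foldCell (c i)) := by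
      intro S
      induction S using Finset.induction_on with
      | empty => simp
      | insert i S hi ih =>
        rw [ih]
        have e1 : (fun j => if j ∈ insert i S then (c j).z / 2 else k j) =
            Function.update (fun j => if j ∈ S then (c j).z / 2 else k j) i ((c i).z / 2) := by
          funext j
          by_cases e : j = i
          · subst e; simp
          · simp [e]
        rw [e1]
        by_cases e : (c i).z / 2 = k i
        · rw [Function.update_eq_self_iff.2 (by simp [hi, e])]
        · have hci := hc i
          have h3 : (c i).z / 2 = (fun j => if j ∈ S then (c j).z / 2 else k j) i + 1 := by
            simp only [hi, if_false]; omega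
          rw [h3, hΦ, hL.mirror_apply]
          simp only [hi, if_false, foldCell]
          rcases Int.emod_two_eq_zero_or_one (k i) with e' | e'
          · rw [if_neg (by omega), if_pos (by omega)]; simp [e']
          · rw [if_pos (by omega)]; simp [e']
    simpa [p] using h Finset.univ
  have key' : ∀ k c, p (cubeMap k c) =
      (Φ k).1 (signedPerm 1 (fun i => decide (k i % 2 = 1)) c) := by
    intro k c
    rw [← key k _ (cubeMap_le_cube k c), foldCell_cubeMap]
  refine ⟨p, fun k => ?_, fun k i => ?_⟩
  · simp only [key']
    exact (Φ k).2.comp _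
  · rw [← cubeMap_top, ← cubeMap_top, key', key', map_top, map_top, hΦ]
    exact hL.mirror_top_ne _ _ _

end IsFlat

end

section

open Seg

variable {n : ℕ} {L : Type*} [Lattice L] [BoundedOrder L]

/-! ### The star of a vertex -/

/-- The vertex `w` of the cubical lattice. -/
def vertex (w : Fin n → ℤ) : Fin n → Cell := fun i => ⟨2 * w i⟩

theorem vertex_le_cube {w k : Fin n → ℤ} :
    vertex w ≤ cube k ↔ ∀ i, k i = w i ∨ k i = w i - 1 := by
  rw [le_cube_iff]
  refine forall_congr' fun i => ?_
  simp only [vertex]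
  omega

theorem exists_vertex_le (c : Fin n → Cell) : ∃ w, vertex w ≤ c :=
  ⟨fun i => (c i).z / 2, fun i => by simp only [vertex, Cell.le_iff]; omega⟩

theorem eq_vertex_of_le {w : Fin n → ℤ} {c : Fin n → Cell} (h : c ≤ vertex w) : c = vertex w := by
  funext i
  have := h i
  simp only [vertex, Cell.le_iff] at this
  ext
  simp only [vertex]
  omega

/-- The index of the cube adjacent to `cube k` across the face `coat i s`. -/
def adjacent (k : Fin n → ℤ) (i : Fin n) (s : Bool) : Fin n → ℤ :=
  Function.update k i (if s then k i + 1 else k i - 1)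

theorem cubeMap_coat_le_adjacent (k : Fin n → ℤ) (i : Fin n) (s : Bool) :
    cubeMap k (coat i s) ≤ cube (adjacent k i s) := by
  rw [le_cube_iff]
  intro j
  by_cases e : j = i
  · subst e; cases s <;> simp only [cubeMap, adjacent, Seg.val, coat_self, Function.update_self] <;>
      simp <;> omega
  · simp [cubeMap, adjacent, e, coat_of_ne s e, Seg.val]

theorem cubeMap_coat_le {k : Fin n → ℤ} {c : Fin n → Seg} (h : c ≠ ⊤) :
    ∃ i s, cubeMap k c ≤ cubeMap k (coat i s) := by
  obtain ⟨i, s, h⟩ := exists_le_coat h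
  exact ⟨i, s, cubeMap_le_iff.2 h⟩

/-- A face of `cube k` in the wall `coat i s` has a constant `i`-th coordinate. -/
theorem le_cubeMap_coat {k : Fin n → ℤ} {c : Fin n → Cell} (h : c ≤ cube k) {i : Fin n} {s : Bool} :
    c ≤ cubeMap k (coat i s) ↔ (c i).z = 2 * k i + (pt s).val := by
  obtain ⟨d, rfl⟩ := exists_cubeMap h
  rw [cubeMap_le_iff, le_coat]
  simp only [cubeMap, add_right_inj]
  rcases d i with (_ | _) | _ <;> rcases s with _ | _ <;> simp [Seg.val]

/-- The intersection of two cubes with the common vertex `w`. -/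
def common (w k l : Fin n → ℤ) : Fin n → Cell :=
  fun i => if k i = l i then ⟨2 * k i + 1⟩ else ⟨2 * w i⟩

theorem common_comm (w k l : Fin n → ℤ) : common w k l = common w l k := by
  funext i
  simp only [common]
  split_ifs with h1 h2 h2 <;> simp_all

theorem common_le {w k l : Fin n → ℤ} (hk : vertex w ≤ cube k) : common w k l ≤ cube k := by
  rw [le_cube_iff]
  rw [vertex_le_cube] at hk
  intro i
  have := hk i
  simp only [common]
  split_ifs <;> (simp; try omega)

/-- The directions in which two cubes differ. -/
def diffDirs (k l : Fin n → ℤ) : Finset (Fin n) := Finset.univ.filter fun i => k i ≠ l i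

theorem mem_diffDirs {k l : Fin n → ℤ} {i : Fin n} : i ∈ diffDirs k l ↔ k i ≠ l i := by
  simp [diffDirs]

namespace IsDeveloping

variable {p : (Fin n → Cell) → L}

theorem coatom (hp : IsDeveloping p) (k : Fin n → ℤ) : IsCoatom (p (cube k)) := (hp.frame k).coatom

theorem ne_bot (hp : IsDeveloping p) (c : Fin n → Cell) : p c ≠ ⊥ := by
  obtain ⟨k, hk⟩ := exists_le_cube c
  obtain ⟨d, rfl⟩ := exists_cubeMap hk
  exact (hp.frame k).ne_bot d

theorem le_iff (hp : IsDeveloping p) {k : Fin n → ℤ} {c d : Fin n → Cell} (hc : c ≤ cube k)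
    (hd : d ≤ cube k) : p c ≤ p d ↔ c ≤ d := by
  obtain ⟨c, rfl⟩ := exists_cubeMap hc
  obtain ⟨d, rfl⟩ := exists_cubeMap hd
  rw [cubeMap_le_iff]
  exact (hp.frame k).le_iff

theorem inj (hp : IsDeveloping p) {k : Fin n → ℤ} {c d : Fin n → Cell} (hc : c ≤ cube k)
    (hd : d ≤ cube k) (h : p c = p d) : c = d :=
  le_antisymm ((hp.le_iff hc hd).1 h.le) ((hp.le_iff hd hc).1 h.ge)

theorem mono (hp : IsDeveloping p) : Monotone p := fun c d h => by
  obtain ⟨k, hk⟩ := exists_le_cube d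
  exact (hp.le_iff (h.trans hk) hk).2 h

theorem ne_top (hp : IsDeveloping p) (c : Fin n → Cell) : p c ≠ ⊤ := by
  obtain ⟨k, hk⟩ := exists_le_cube c
  exact fun h => (hp.coatom k).1 (top_le_iff.1 (h ▸ hp.mono hk))

theorem surj (hp : IsDeveloping p) {k : Fin n → ℤ} {x : L} (hx : x ≠ ⊥) (h : x ≤ p (cube k)) :
    ∃ c, c ≤ cube k ∧ p c = x := by
  obtain ⟨d, hd⟩ := (hp.frame k).surj x hx h
  exact ⟨cubeMap k d, cubeMap_le_cube k d, hd⟩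

theorem isAtom_vertex (hp : IsDeveloping p) (w : Fin n → ℤ) : IsAtom (p (vertex w)) := by
  refine ⟨hp.ne_bot _, fun x hx => ?_⟩
  by_contra h
  obtain ⟨k, hk⟩ := exists_le_cube (vertex w)
  obtain ⟨c, hc, rfl⟩ := hp.surj h (hx.le.trans (hp.mono hk))
  have := eq_vertex_of_le ((hp.le_iff hc hk).1 hx.le)
  exact hx.ne (by rw [this])

theorem adjacent_ne (hp : IsDeveloping p) (k : Fin n → ℤ) (i : Fin n) (s : Bool) :
    p (cube (adjacent k i s)) ≠ p (cube k) := by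
  cases s
  · have h := hp.adj (adjacent k i false) i
    have e : Function.update (adjacent k i false) i (adjacent k i false i + 1) = k := by
      simp [adjacent]
    rw [e] at h
    exact h.symm
  · exact hp.adj k i

/-- The facets that contain a face of codimension one are the two adjacent ones. -/
theorem eq_or_eq_adjacent (hp : IsDeveloping p) (hL : IsFlat n L) {k : Fin n → ℤ} {i : Fin n}
    {s : Bool} {G : L} (hG : IsCoatom G) (h : p (cubeMap k (coat i s)) ≤ G) :
    G = p (cube k) ∨ G = p (cube (adjacent k i s)) := by
  by_contra! hcon
  exact hL.not_three (hp.frame k) hG (hp.coatom k) (hp.coatom (adjacent k i s)) h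
    ((hp.frame k).le_top _) (hp.mono (cubeMap_coat_le_adjacent k i s)) hcon.1 hcon.2
    (hp.adjacent_ne k i s).symm

/-- The meet of two adjacent facets is their common face of codimension one. -/
theorem le_coat_of_le_adjacent (hp : IsDeveloping p) {k : Fin n → ℤ} {i : Fin n} {s : Bool}
    {c : Fin n → Cell} (hc : c ≤ cube k) (h : p c ≤ p (cube (adjacent k i s))) :
    c ≤ cubeMap k (coat i s) := by
  have h1 : p (cubeMap k (coat i s)) ≤ p (cube k) ⊓ p (cube (adjacent k i s)) :=
    le_inf (hp.mono (cubeMap_le_cube k _)) (hp.mono (cubeMap_coat_le_adjacent k i s))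
  obtain ⟨d, hd⟩ := (hp.frame k).surj (p (cube k) ⊓ p (cube (adjacent k i s)))
    (fun e => hp.ne_bot _ (le_bot_iff.1 (e ▸ h1))) inf_le_left
  have hdt : d ≠ ⊤ := by
    rintro rfl
    exact hp.adjacent_ne k i s
      ((hp.coatom k).eq_of_le_coatom (hp.coatom _) (hd.le.trans inf_le_right)).symm
  have h2 : coat i s ≤ d := by rw [← (hp.frame k).le_iff]; exact h1.trans hd.ge
  rw [← eq_of_coat_le h2 hdt, ← hp.le_iff hc (cubeMap_le_cube k _), hd]
  exact le_inf (hp.mono hc) h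

/-- A predicate on the cubes which is passed on to adjacent cubes across faces above `x` is realized
by all facets above `x`, if these are connected. -/
theorem exists_cube_of_connected (hp : IsDeveloping p) (hL : IsFlat n L) (hn : 0 < n) {x : L}
    (hx : FacetsConnectedAbove x) {Q : (Fin n → ℤ) → Prop} {k : Fin n → ℤ} (hk : Q k)
    (hxk : x ≤ p (cube k)) (hQ : ∀ k i s, Q k → x ≤ p (cubeMap k (coat i s)) → Q (adjacent k i s))
    {G : L} (hG : IsCoatom G) (hxG : x ≤ G) : ∃ l, Q l ∧ p (cube l) = G := by
  have h := hx _ _ (hp.coatom k) hG hxk hxG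
  clear hG hxG
  induction h with
  | refl => exact ⟨k, hk, rfl⟩
  | @tail A B _ hAB ih =>
    obtain ⟨l, hl, rfl⟩ := ih
    obtain ⟨-, hB, r, hxr, hrA, hrB⟩ := hAB
    have hr : ∃ i s, r ≤ p (cubeMap l (coat i s)) := by
      by_cases hr : r = ⊥
      · exact ⟨⟨0, hn⟩, false, hr ▸ bot_le⟩
      · obtain ⟨d, hd⟩ := (hp.frame l).surj r hr hrA.le
        have hdt : d ≠ ⊤ := by
          rintro rfl
          exact hrA.ne hd.symm
        obtain ⟨i, s, h⟩ := cubeMap_coat_le (k := l) hdt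
        exact ⟨i, s, hd ▸ hp.mono h⟩
    obtain ⟨i, s, hr⟩ := hr
    have hr' : r = p (cubeMap l (coat i s)) := by
      refine ((hrA.eq_or_eq hr ((hp.frame l).le_top _)).resolve_right fun e => ?_).symm
      exact coat_ne_top i s ((hp.frame l).inj e)
    subst hr'
    rcases hp.eq_or_eq_adjacent hL hB hrB.le with e | e
    · exact ⟨l, hl, e.symm⟩
    · exact ⟨_, hQ l i s hl hxr, e.symm⟩

/-- Different cubes with a common vertex are mapped to different facets. If `cube k` and `cube l`
have the same image, then so do the cubes `cube k₁` and `cube l₁` behind corresponding walls, and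
these differ in fewer directions: the lattice property forces the crossing from `cube k` to go
towards `cube l₁`. -/
theorem cube_inj_of_vertex_le (hp : IsDeveloping p) (hL : IsFlat n L) {w k l : Fin n → ℤ}
    (hk : vertex w ≤ cube k) (hl : vertex w ≤ cube l) (h : p (cube k) = p (cube l)) : k = l := by
  induction hN : (diffDirs k l).card using Nat.strong_induction_on generalizing k l with
  | _ N ih =>
  by_contra hne
  obtain ⟨i, hi⟩ := Function.ne_iff.1 hne
  have hk' := vertex_le_cube.1 hk
  have hl' := vertex_le_cube.1 hl
  -- cross from `cube l` to `cube l₁` in the direction `i`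
  obtain ⟨s, hs⟩ : ∃ s : Bool, 2 * w i = 2 * l i + (pt s).val := by
    rcases hl' i with e | e
    · exact ⟨false, by simp [Seg.val]; omega⟩
    · exact ⟨true, by simp [Seg.val]; omega⟩
  set l₁ := adjacent l i s with hl₁
  have hvr : vertex w ≤ cubeMap l (coat i s) := (le_cubeMap_coat hl).2 hs
  have hvl₁ : vertex w ≤ cube l₁ := hvr.trans (cubeMap_coat_le_adjacent l i s)
  have hl₁i : l₁ i = k i := by
    have h1 := hk' i; have h2 := hl' i; have h3 := vertex_le_cube.1 hvl₁ i
    have h4 : l₁ i ≠ l i := by simp only [hl₁, adjacent]; cases s <;> simp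
    omega
  have hl₁j : ∀ j, j ≠ i → l₁ j = l j := fun j hj => by simp [hl₁, adjacent, hj]
  -- in the facet of `cube k` the wall that was crossed appears in some direction `j`
  obtain ⟨j, t, hj⟩ := (hp.frame l).exists_coat (hp.frame k) h.symm i s
  have hvj : vertex w ≤ cubeMap k (coat j t) := by
    rw [← hp.le_iff hk (cubeMap_le_cube k _), ← hj]; exact hp.mono hvr
  set k₁ := adjacent k j t with hk₁
  have hvk₁ : vertex w ≤ cube k₁ := hvj.trans (cubeMap_coat_le_adjacent k j t)
  have e₁ : p (cube l₁) = p (cube k₁) := by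
    refine (hp.eq_or_eq_adjacent hL (i := j) (s := t) (hp.coatom l₁) ?_).resolve_left ?_
    · rw [← hj]; exact hp.mono (cubeMap_coat_le_adjacent l i s)
    · rw [h]; exact hp.adjacent_ne l i s
  have hc : common w k l₁ ≤ cubeMap k (coat j t) := by
    refine hp.le_coat_of_le_adjacent (common_le hk) ?_
    rw [← hk₁, ← e₁]
    rw [common_comm]; exact hp.mono (common_le hvl₁)
  have hkj : k j ≠ l₁ j := by
    intro e
    have h1 := hc j
    have h2 : common w k l₁ j = ⟨2 * k j + 1⟩ := by simp [common, e]
    rw [h2] at h1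
    cases t <;> simp [cubeMap, Seg.val, Cell.le_iff] at h1
  have hji : j ≠ i := by rintro rfl; exact hkj hl₁i.symm
  have hk₁j : k₁ j = l₁ j := by
    have h1 := hk' j; have h2 := vertex_le_cube.1 hvk₁ j; have h3 := vertex_le_cube.1 hvl₁ j
    have h4 : k₁ j ≠ k j := by simp only [hk₁, adjacent]; cases t <;> simp
    omega
  have hk₁m : ∀ m, m ≠ j → k₁ m = k m := fun m hm => by simp [hk₁, adjacent, hm]
  have hlt : diffDirs k₁ l₁ ⊂ diffDirs k l := by
    rw [Finset.ssubset_iff_of_subset]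
    · exact ⟨i, mem_diffDirs.2 hi, fun h => mem_diffDirs.1 h (by rw [hk₁m i hji.symm, hl₁i])⟩
    · intro m hm
      rw [mem_diffDirs] at hm ⊢
      have hmj : m ≠ j := by rintro rfl; exact hm hk₁j
      have hmi : m ≠ i := by rintro rfl; exact hm (by rw [hk₁m m hmj, hl₁i])
      rwa [hk₁m m hmj, hl₁j m hmi] at hm
  have key := ih _ (hN ▸ Finset.card_lt_card hlt) hvk₁ hvl₁ e₁.symm rfl
  -- two different walls of `cube k₁` are mapped to the same face
  have h1 : cubeMap l (coat i s) = cubeMap k (coat j t) := hp.inj (k := k₁)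
    (key ▸ cubeMap_coat_le_adjacent l i s) (cubeMap_coat_le_adjacent k j t) hj
  have h2 := congrArg Cell.z (congrFun h1 i)
  simp only [cubeMap, coat_self, coat_of_ne t hji.symm, ← hs, Seg.val.eq_3] at h2
  omega

/-- In the star of a vertex, the developing map reflects incidence with cubes: the meet of the
images of two cubes is the image of a face of a wall, through which one gets closer to the second
cube. -/
theorem le_cube_of_vertex_le (hp : IsDeveloping p) (hL : IsFlat n L) {w k l : Fin n → ℤ}
    {c : Fin n → Cell} (hk : vertex w ≤ cube k) (hl : vertex w ≤ cube l)
    (hck : c ≤ cube k) (h : p c ≤ p (cube l)) : c ≤ cube l := by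
  induction hN : (diffDirs k l).card using Nat.strong_induction_on generalizing k l c with
  | _ N ih =>
  have hm : p (common w k l) ≤ p (cube k) ⊓ p (cube l) :=
    le_inf (hp.mono (common_le hk)) (by rw [common_comm]; exact hp.mono (common_le hl))
  obtain ⟨d, hd, hpd⟩ := hp.surj (k := k) (x := p (cube k) ⊓ p (cube l))
    (fun e => hp.ne_bot _ (le_bot_iff.1 (e ▸ hm))) inf_le_left
  have hcd : c ≤ d := by rw [← hp.le_iff hck hd, hpd]; exact le_inf (hp.mono hck) h
  have hmd : common w k l ≤ d := by rw [← hp.le_iff (common_le hk) hd, hpd]; exact hm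
  refine hcd.trans ?_
  obtain ⟨d, rfl⟩ := exists_cubeMap hd
  by_cases hdt : d = ⊤
  · subst hdt
    have e : p (cube k) = p (cube l) :=
      (hp.coatom k).eq_of_le_coatom (hp.coatom l) (hpd.le.trans inf_le_right)
    rw [hp.cube_inj_of_vertex_le hL hk hl e] at hd
    rw [hp.cube_inj_of_vertex_le hL hk hl e]; exact hd
  · obtain ⟨i, s, hi⟩ := cubeMap_coat_le (k := k) hdt
    have h1 := (hmd.trans hi) i
    have hki : k i ≠ l i := by
      intro e
      have h2 : common w k l i = ⟨2 * k i + 1⟩ := by simp [common, e]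
      rw [h2] at h1
      cases s <;> simp [cubeMap, Seg.val, Cell.le_iff] at h1
    have h2 : common w k l i = ⟨2 * w i⟩ := by simp [common, hki]
    rw [h2] at h1
    have hv : vertex w ≤ cubeMap k (coat i s) := (le_cubeMap_coat hk).2 (by
      cases s <;> (simp [cubeMap, Seg.val, Cell.le_iff, vertex] at h1 ⊢; omega))
    have hk₁ : vertex w ≤ cube (adjacent k i s) := hv.trans (cubeMap_coat_le_adjacent k i s)
    have hk₁j : ∀ j, j ≠ i → adjacent k i s j = k j := fun j hj => by simp [adjacent, hj]
    have hk₁i : adjacent k i s i = l i := by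
      have h1 := vertex_le_cube.1 hk i; have h2 := vertex_le_cube.1 hk₁ i
      have h3 := vertex_le_cube.1 hl i
      have h4 : adjacent k i s i ≠ k i := by simp only [adjacent]; cases s <;> simp
      omega
    have hlt : diffDirs (adjacent k i s) l ⊂ diffDirs k l := by
      rw [Finset.ssubset_iff_of_subset]
      · exact ⟨i, mem_diffDirs.2 hki, fun h => mem_diffDirs.1 h hk₁i⟩
      · intro m hm
        rw [mem_diffDirs] at hm ⊢
        have hmi : m ≠ i := by rintro rfl; exact hm hk₁i
        rwa [hk₁j m hmi] at hm
    exact ih _ (hN ▸ Finset.card_lt_card hlt) hk₁ hl (hi.trans (cubeMap_coat_le_adjacent k i s))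
      (hpd.le.trans inf_le_right) rfl

/-- On the star of a vertex, the developing map is an order embedding. -/
theorem le_of_vertex_le (hp : IsDeveloping p) (hL : IsFlat n L) {w : Fin n → ℤ}
    {c d : Fin n → Cell} (hc : vertex w ≤ c) (hd : vertex w ≤ d) (h : p c ≤ p d) : c ≤ d := by
  obtain ⟨k, hk⟩ := exists_le_cube c
  have key : ∀ l, d ≤ cube l → c ≤ cube l := fun l hl =>
    hp.le_cube_of_vertex_le hL (hc.trans hk) (hd.trans hl) hk (h.trans (hp.mono hl))
  -- a face is the intersection of the cubes that contain it
  have h1 := le_cube_iff.1 (key (fun i => (d i).z / 2) (le_cube_iff.2 fun i => by omega))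
  have h2 := le_cube_iff.1 (key (fun i => ((d i).z - 1) / 2) (le_cube_iff.2 fun i => by omega))
  intro i
  have h1 := h1 i
  have h2 := h2 i
  rw [Cell.le_iff]
  omega

/-- By connectedness of the star, all facets around the image of a vertex are images of cubes around
the vertex. -/
theorem exists_cube_of_vertex_le (hp : IsDeveloping p) (hL : IsFlat n L) (hn : 0 < n)
    (hK : ∀ v : L, IsAtom v → FacetsConnectedAbove v) {w : Fin n → ℤ} {G : L} (hG : IsCoatom G)
    (h : p (vertex w) ≤ G) : ∃ l, vertex w ≤ cube l ∧ p (cube l) = G := by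
  obtain ⟨k, hk⟩ := exists_le_cube (vertex w)
  refine hp.exists_cube_of_connected hL hn (hK _ (hp.isAtom_vertex w))
    (Q := fun l => vertex w ≤ cube l) hk (hp.mono hk) (fun l i s hl hr => ?_) hG h
  exact ((hp.le_iff hl (cubeMap_le_cube l _)).1 hr).trans (cubeMap_coat_le_adjacent l i s)

end IsDeveloping

end

section

open Seg

/-! ### The developing map is a covering of posets -/

/-- A covering of partially ordered sets: a monotone map which induces order isomorphisms from the
elements above `p` (below `p`) to the elements above `f p` (below `f p`). -/
structure IsPosetCovering {P Q : Type*} [PartialOrder P] [PartialOrder Q] (f : P → Q) : Prop where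
  mono : Monotone f
  exists_ge : ∀ p q, f p ≤ q → ∃ p', p ≤ p' ∧ f p' = q
  exists_le : ∀ p q, q ≤ f p → ∃ p', p' ≤ p ∧ f p' = q
  le_of_ge : ∀ p a b, p ≤ a → p ≤ b → f a ≤ f b → a ≤ b
  le_of_le : ∀ p a b, a ≤ p → b ≤ p → f a ≤ f b → a ≤ b

variable {n : ℕ} {L : Type*} [Lattice L] [BoundedOrder L]

namespace IsDeveloping

variable {p : (Fin n → Cell) → L}

theorem exists_ge (hp : IsDeveloping p) (hL : IsFlat n L) (hn : 0 < n)
    (hK : IsClosedCubicalComplex n L) (c : Fin n → Cell) {y : L} (hy : y ≠ ⊤) (h : p c ≤ y) :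
    ∃ d, c ≤ d ∧ p d = y := by
  obtain ⟨F, hF, hyF⟩ := hK.exists_facet y hy
  obtain ⟨w, hw⟩ := exists_vertex_le c
  obtain ⟨k, hk, rfl⟩ := hp.exists_cube_of_vertex_le hL hn hK.star_connected hF
    ((hp.mono hw).trans (h.trans hyF))
  have hck := hp.le_of_vertex_le hL hw hk (h.trans hyF)
  obtain ⟨d, hd, rfl⟩ := hp.surj (fun e => hp.ne_bot c (le_bot_iff.1 (e ▸ h))) hyF
  exact ⟨d, (hp.le_iff hck hd).1 h, rfl⟩

theorem surjective (hp : IsDeveloping p) (hL : IsFlat n L) (hn : 0 < n)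
    (hK : IsClosedCubicalComplex n L) {y : L} (hb : y ≠ ⊥) (ht : y ≠ ⊤) : ∃ d, p d = y := by
  obtain ⟨F, hF, hyF⟩ := hK.exists_facet y ht
  obtain ⟨k, -, rfl⟩ := hp.exists_cube_of_connected hL hn hK.connected (Q := fun _ => True)
    (k := 0) trivial bot_le (fun _ _ _ _ _ => trivial) hF bot_le
  obtain ⟨d, -, hd⟩ := hp.surj hb hyF
  exact ⟨d, hd⟩

/-- The developing map as a map to the poset of non-empty proper faces. -/
def toProperFace (hp : IsDeveloping p) (c : Fin n → Cell) : ProperFace L :=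
  ⟨p c, hp.ne_bot c, hp.ne_top c⟩

theorem isPosetCovering (hp : IsDeveloping p) (hL : IsFlat n L) (hn : 0 < n)
    (hK : IsClosedCubicalComplex n L) : IsPosetCovering hp.toProperFace where
  mono _ _ h := hp.mono h
  exists_ge c y h := by
    obtain ⟨d, hd, e⟩ := hp.exists_ge hL hn hK c y.2.2 h
    exact ⟨d, hd, Subtype.ext e⟩
  exists_le c y h := by
    obtain ⟨k, hk⟩ := exists_le_cube c
    have h' : y.1 ≤ p c := h
    obtain ⟨d, hd, e⟩ := hp.surj y.2.1 (h'.trans (hp.mono hk))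
    exact ⟨d, (hp.le_iff hd hk).1 (e.le.trans h'), Subtype.ext e⟩
  le_of_ge c a b ha hb h := by
    obtain ⟨w, hw⟩ := exists_vertex_le c
    exact hp.le_of_vertex_le hL (hw.trans ha) (hw.trans hb) h
  le_of_le c a b ha hb h := by
    obtain ⟨k, hk⟩ := exists_le_cube c
    exact (hp.le_iff (ha.trans hk) (hb.trans hk)).1 h

/-- The symmetries of the developing map act transitively on its fibres: two cubes over the same
facet differ by a symmetry of the lattice, which preserves the developing map on one cube and hence
everywhere. -/
theorem exists_cellSymm (hp : IsDeveloping p) (hL : IsFlat n L) (hn : 0 < n)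
    (hK : IsClosedCubicalComplex n L) {c c' : Fin n → Cell} (h : p c = p c') :
    ∃ σ ε t, p ∘ cellSymm σ ε t = p ∧ cellSymm σ ε t c = c' := by
  obtain ⟨k, hk⟩ := exists_le_cube c
  obtain ⟨d, hd, hdk⟩ := hp.exists_ge hL hn hK c' (hp.ne_top (cube k)) (h.ge.trans (hp.mono hk))
  obtain ⟨k', hk'⟩ := exists_le_cube d
  have hdk' : d = cube k' := hp.inj hk' le_rfl
    ((hdk.symm ▸ hp.coatom k : IsCoatom (p d)).eq_of_le_coatom (hp.coatom k') (hp.mono hk'))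
  subst hdk'
  obtain ⟨σ, b, hσ⟩ := (hp.frame k').exists_signedPerm (hp.frame k) hdk
  let ε : Fin n → ℤˣ := fun i => if b i then -1 else 1
  let t : Fin n → ℤ := fun i => if ε i = 1 then k' i - k (σ i) else k' i + k (σ i) + 1
  have hb : (fun i => decide (ε i = -1)) = b := by
    funext i
    cases h : b i <;> simp [ε, h]
  have hi : indexSymm σ ε t k = k' := by
    funext i
    simp only [indexSymm, t]
    split_ifs <;> ring
  have hg : p ∘ cellSymm σ ε t = p := by
    refine (hp.comp_cellSymm σ ε t).eq_of_agree hL hp k fun e => ?_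
    rw [Function.comp_apply, cellSymm_cubeMap, hi, hb]
    exact hσ e
  refine ⟨σ, ε, t, hg, hp.inj (k := k') ?_ hd ((congrFun hg c).trans h)⟩
  rw [← hi, ← cellSymm_cube, cellSymm_le_iff]
  exact hk

/-- A symmetry of the developing map that fixes a face is the identity: it fixes a vertex, and hence
all edges at this vertex. -/
theorem cellSymm_eq_one (hp : IsDeveloping p) (hL : IsFlat n L) {σ : Equiv.Perm (Fin n)}
    {ε : Fin n → ℤˣ} {t : Fin n → ℤ} (h : p ∘ cellSymm σ ε t = p) {c : Fin n → Cell}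
    (hc : cellSymm σ ε t c = c) : ∀ i, σ i = i ∧ ε i = 1 ∧ t i = 0 := by
  have hpg : ∀ d, p (cellSymm σ ε t d) = p d := congrFun h
  obtain ⟨w, hw⟩ := exists_vertex_le c
  obtain ⟨k, hk⟩ := exists_le_cube c
  have hv : cellSymm σ ε t (vertex w) = vertex w := by
    refine hp.inj (k := k) (le_trans ?_ hk) (hw.trans hk) (hpg _)
    calc cellSymm σ ε t (vertex w) ≤ cellSymm σ ε t c := (cellSymm_le_iff σ ε t).2 hw
      _ = c := hc
  have hfix : ∀ d, vertex w ≤ d → cellSymm σ ε t d = d := by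
    intro d hd
    have hd' : vertex w ≤ cellSymm σ ε t d := by rw [← hv]; exact (cellSymm_le_iff σ ε t).2 hd
    exact le_antisymm (hp.le_of_vertex_le hL hd' hd (hpg d).le)
      (hp.le_of_vertex_le hL hd hd' (hpg d).ge)
  intro i
  have h1 := congrArg Cell.z (congrFun hv i)
  have hle : vertex w ≤ Function.update (vertex w) (σ i) ⟨2 * w (σ i) + 1⟩ := by
    intro j
    by_cases e : j = σ i
    · subst e; simp [vertex, Cell.le_iff]
    · simp [e]
  have h2 := congrArg Cell.z (congrFun (hfix _ hle) i)
  by_cases e : i = σ i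
  · refine ⟨e.symm, ?_⟩
    simp only [cellSymm, vertex, Function.update_self] at h1 h2
    rw [← e] at h1 h2
    simp only [Function.update_self] at h2
    rcases Int.units_eq_one_or (ε i) with e' | e' <;> rw [e'] at h1 h2 ⊢ <;> push_cast at h1 h2
    · exact ⟨rfl, by omega⟩
    · omega
  · exfalso
    simp only [cellSymm, vertex, Function.update_self, ne_eq, e, not_false_eq_true,
      Function.update_of_ne] at h1 h2
    rcases Int.units_eq_one_or (ε i) with e' | e' <;> rw [e'] at h1 h2 <;> push_cast at h1 h2 <;>
      omega

end IsDeveloping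

end

section

/-! ### Order complexes -/

theorem Finsupp.mapDomain_apply_eq_sum_ite {P Q : Type*} (f : P → Q) {w : P →₀ ℝ}
    {c : Finset P} (h : w.support ⊆ c) (y : Q) [DecidableEq Q] :
    w.mapDomain f y = ∑ x ∈ c, if f x = y then w x else 0 := by
  rw [Finsupp.mapDomain, Finsupp.sum_of_support_subset _ h _ (by simp), Finset.sum_apply']
  simp [Finsupp.single_apply]

namespace OrderComplex

variable {P Q : Type*} [PartialOrder P] [PartialOrder Q]

theorem isOpen_iff {U : Set (OrderComplex P)} : IsOpen U ↔
    ∀ c : Finset P, IsChain (· ≤ ·) (c : Set P) → IsOpen {w : Simplex c | w.1 ∈ U} := by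
  rw [OrderComplex.instTopologicalSpace, isOpen_iSup_iff]
  simp only [isOpen_coinduced, Subtype.forall]
  rfl

theorem continuous_of_simplex {Y : Type*} [TopologicalSpace Y] {f : OrderComplex P → Y}
    (h : ∀ c : Finset P, IsChain (· ≤ ·) (c : Set P) → Continuous fun w : Simplex c => f w.1) :
    Continuous f :=
  continuous_def.2 fun _ hV => isOpen_iff.2 fun c hc => hV.preimage (h c hc)

theorem continuous_simplex_val {c : Finset P} (hc : IsChain (· ≤ ·) (c : Set P)) :
    Continuous fun w : Simplex c => w.1 :=
  continuous_def.2 fun _ hU => isOpen_iff.1 hU c hc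

theorem continuous_coord (c : Finset P) (x : P) : Continuous fun w : Simplex c => w.1.1 x :=
  (continuous_apply x).comp continuous_induced_dom

theorem continuous_simplex_mk {c : Finset P} {Y : Type*} [TopologicalSpace Y] {f : Y → Simplex c}
    (h : ∀ x, Continuous fun y => (f y).1.1 x) : Continuous f :=
  continuous_induced_rng.2 (continuous_pi h)

/-- The map of order complexes that is induced by a map `f` of the vertices, at a point whose
support is mapped to a chain. -/
noncomputable def map (f : P → Q) (w : OrderComplex P)
    (h : IsChain (· ≤ ·) (f '' (w.1.support : Set P))) : OrderComplex Q :=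
  ⟨w.1.mapDomain f, fun x => by
    classical
    rw [Finsupp.mapDomain_apply_eq_sum_ite f subset_rfl]
    exact Finset.sum_nonneg fun y _ => by split_ifs; exacts [w.2.1 y, le_rfl], by
    classical
    refine h.mono ?_
    exact (Finset.coe_subset.2 Finsupp.mapDomain_support).trans (by simp), by
    rw [Finsupp.sum_mapDomain_index (fun _ => rfl) (fun _ _ _ => rfl)]
    exact w.2.2.2⟩

theorem continuous_map (f : P → Q) {c : Finset P} (hf : IsChain (· ≤ ·) (f '' (c : Set P))) :
    Continuous fun w : Simplex c => map f w.1 (hf.mono (Set.image_mono w.2)) := by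
  classical
  let g : Simplex c → Simplex (c.image f) := fun w => ⟨map f w.1 (hf.mono (Set.image_mono w.2)),
    Finsupp.mapDomain_support.trans (Finset.image_subset_image w.2)⟩
  have hg : Continuous g := continuous_simplex_mk fun x => by
    simp only [g, map, fun w : Simplex c => Finsupp.mapDomain_apply_eq_sum_ite f w.2 x]
    refine continuous_finsetSum _ fun y _ => ?_
    split_ifs
    exacts [continuous_coord c y, continuous_const]
  exact (continuous_simplex_val (by simpa using hf)).comp hg

theorem exists_mem_support (w : OrderComplex P) : ∃ x, x ∈ w.1.support := by
  by_contra! h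
  have h0 : w.1 = 0 := Finsupp.support_eq_empty.1 (Finset.eq_empty_of_forall_notMem h)
  have := w.2.2.2
  rw [h0] at this
  simp at this

theorem comparable (w : OrderComplex P) {x y : P} (hx : x ∈ w.1.support) (hy : y ∈ w.1.support) :
    x ≤ y ∨ y ≤ x := w.2.2.1.total hx hy

/-- The open star of a vertex of the order complex. -/
def openStar (x : P) : Set (OrderComplex P) := {w | w.1 x ≠ 0}

theorem mem_openStar {x : P} {w : OrderComplex P} : w ∈ openStar x ↔ x ∈ w.1.support := by
  simp [openStar]

theorem isOpen_openStar (x : P) : IsOpen (openStar x) :=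
  isOpen_iff.2 fun c _ => isOpen_ne_fun (continuous_coord c x) continuous_const

/-- The vertex of the order complex given by an element of the poset. -/
noncomputable def point (x : P) : OrderComplex P :=
  ⟨Finsupp.single x 1, fun y => by
    classical
    rw [Finsupp.single_apply]; split_ifs <;> simp, by
    simp [Finsupp.support_single], by simp⟩

theorem point_mem_openStar {x y : P} : point x ∈ openStar y ↔ x = y := by
  classical
  change Finsupp.single x (1 : ℝ) y ≠ 0 ↔ x = y
  simp [Finsupp.single_apply]

theorem point_injective : Function.Injective (point : P → OrderComplex P) := fun _ _ h =>
  (point_mem_openStar.1 (h ▸ point_mem_openStar.2 rfl)).symm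

theorem joined_point {x y : P} (h : x ≤ y) : Joined (point x) (point y) := by
  classical
  have hc : IsChain (· ≤ ·) (({x, y} : Finset P) : Set P) := by
    simpa using IsChain.pair h
  let g : unitInterval → Simplex ({x, y} : Finset P) := fun s =>
    ⟨⟨Finsupp.single x (1 - s : ℝ) + Finsupp.single y (s : ℝ), fun z => by
      have h1 := unitInterval.one_minus_nonneg s
      have h2 := unitInterval.nonneg s
      simp only [Finsupp.add_apply, Finsupp.single_apply]
      split_ifs <;> simp [h1, h2], by
      refine hc.mono (Finset.coe_subset.2 (Finsupp.support_add.trans ?_))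
      refine Finset.union_subset (Finsupp.support_single_subset.trans (by simp))
        (Finsupp.support_single_subset.trans (by simp)), by
      rw [Finsupp.sum_add_index' (fun _ => rfl) (fun _ _ _ => rfl),
        Finsupp.sum_single_index rfl, Finsupp.sum_single_index rfl, sub_add_cancel]⟩,
      Finsupp.support_add.trans (Finset.union_subset
        (Finsupp.support_single_subset.trans (by simp))
        (Finsupp.support_single_subset.trans (by simp)))⟩
  have hg : Continuous g := continuous_simplex_mk fun z => by
    simp only [g, Finsupp.add_apply, Finsupp.single_apply]
    split_ifs <;> fun_prop
  refine ⟨⟨⟨fun s => (g s).1, (continuous_simplex_val hc).comp hg⟩, ?_, ?_⟩⟩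
  · exact Subtype.ext (by simp [g, point])
  · exact Subtype.ext (by simp [g, point])

/-- A poset with compact order complex is finite. -/
theorem finite_of_compactSpace [CompactSpace (OrderComplex P)] : Finite P := by
  obtain ⟨t, ht⟩ := isCompact_univ.elim_finite_subcover (fun x : P => openStar x) isOpen_openStar
    (fun w _ => by
      obtain ⟨x, hx⟩ := w.exists_mem_support
      exact Set.mem_iUnion.2 ⟨x, mem_openStar.2 hx⟩)
  refine Set.finite_univ_iff.1 (t.finite_toSet.subset fun x _ => ?_)
  obtain ⟨y, hy⟩ := Set.mem_iUnion.1 (ht (Set.mem_univ (point x)))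
  obtain ⟨hyt, hy⟩ := Set.mem_iUnion.1 hy
  rw [point_mem_openStar] at hy
  exact hy ▸ hyt

end OrderComplex

namespace IsPosetCovering

open OrderComplex

variable {P Q : Type*} [PartialOrder P] [PartialOrder Q] {f : P → Q}

theorem isChain_image (hf : IsPosetCovering f) (w : OrderComplex P) :
    IsChain (· ≤ ·) (f '' (w.1.support : Set P)) := by
  rintro _ ⟨x, hx, rfl⟩ _ ⟨y, hy, rfl⟩ -
  exact (w.comparable hx hy).imp (fun h => hf.mono h) (fun h => hf.mono h)

/-- The map of order complexes induced by a covering of posets. -/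
noncomputable def realize (hf : IsPosetCovering f) (w : OrderComplex P) : OrderComplex Q :=
  map f w (hf.isChain_image w)

theorem continuous_realize (hf : IsPosetCovering f) : Continuous hf.realize :=
  continuous_of_simplex fun c hc => continuous_map f (c := c) (by
    rintro _ ⟨x, hx, rfl⟩ _ ⟨y, hy, rfl⟩ -
    exact (hc.total hx hy).imp (fun h => hf.mono h) (fun h => hf.mono h))

theorem realize_point (hf : IsPosetCovering f) (x : P) : hf.realize (point x) = point (f x) :=
  Subtype.ext Finsupp.mapDomain_single

theorem eq_of_ge (hf : IsPosetCovering f) {p a b : P} (ha : p ≤ a) (hb : p ≤ b) (h : f a = f b) :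
    a = b := le_antisymm (hf.le_of_ge p a b ha hb h.le) (hf.le_of_ge p b a hb ha h.ge)

theorem eq_of_le (hf : IsPosetCovering f) {p a b : P} (ha : a ≤ p) (hb : b ≤ p) (h : f a = f b) :
    a = b := le_antisymm (hf.le_of_le p a b ha hb h.le) (hf.le_of_le p b a hb ha h.ge)

theorem eq_of_comparable (hf : IsPosetCovering f) {a b : P} (h : a ≤ b ∨ b ≤ a) (e : f a = f b) :
    a = b := h.elim (fun h => hf.eq_of_le h le_rfl e) (fun h => hf.eq_of_le le_rfl h e)

/-- The section of a covering of posets over the elements comparable to `f p`, with value `p` at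
`f p`. -/
theorem exists_lift (hf : IsPosetCovering f) (p : P) : ∃ l : Q → P,
    (∀ q, f p ≤ q ∨ q ≤ f p → f (l q) = q) ∧
    (∀ a, p ≤ a ∨ a ≤ p → l (f a) = a) ∧
    ∀ q r, (f p ≤ q ∨ q ≤ f p) → (f p ≤ r ∨ r ≤ f p) → q ≤ r → l q ≤ l r := by
  have h : ∀ q, ∃ a, (f p ≤ q → p ≤ a) ∧ (q ≤ f p → a ≤ p) ∧ (f p ≤ q ∨ q ≤ f p → f a = q) := by
    intro q
    by_cases h1 : f p ≤ q
    · obtain ⟨a, ha, e⟩ := hf.exists_ge p q h1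
      refine ⟨a, fun _ => ha, fun h2 => ?_, fun _ => e⟩
      exact (hf.eq_of_ge ha le_rfl (e.trans (le_antisymm h2 h1))).le
    · by_cases h2 : q ≤ f p
      · obtain ⟨a, ha, e⟩ := hf.exists_le p q h2
        exact ⟨a, fun h => (h1 h).elim, fun _ => ha, fun _ => e⟩
      · exact ⟨p, fun h => (h1 h).elim, fun h => (h2 h).elim, fun h => (h.elim h1 h2).elim⟩
  choose l h1 h2 h3 using h
  refine ⟨l, h3, fun a ha => ?_, fun q r hq hr hqr => ?_⟩
  · have e := h3 (f a) (ha.imp (fun h => hf.mono h) (fun h => hf.mono h))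
    rcases ha with ha | ha
    · exact hf.eq_of_ge (h1 _ (hf.mono ha)) ha e
    · exact hf.eq_of_le (h2 _ (hf.mono ha)) ha e
  · have hle : f (l q) ≤ f (l r) := by rwa [h3 q hq, h3 r hr]
    rcases hq with hq' | hq'
    · exact hf.le_of_ge p _ _ (h1 _ hq') (h1 _ (hq'.trans hqr)) hle
    · rcases hr with hr' | hr'
      · exact (h2 _ hq').trans (h1 _ hr')
      · exact hf.le_of_le p _ _ (h2 _ hq') (h2 _ hr') hle

theorem exists_of_mem_openStar (hf : IsPosetCovering f) {w : OrderComplex P} {q : Q}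
    (h : hf.realize w ∈ openStar q) : ∃ p ∈ w.1.support, f p = q := by
  classical
  simpa using Finsupp.mapDomain_support (mem_openStar.1 h)

/-- The realization of a covering of posets is a covering map: the open star of a vertex is evenly
covered by the open stars of its preimages. -/
theorem isCoveringMap (hf : IsPosetCovering f) : IsCoveringMap hf.realize := by
  classical
  intro x
  obtain ⟨q, hq⟩ := x.exists_mem_support
  let I := {p : P // f p = q}
  let _ : TopologicalSpace I := ⊥
  have : DiscreteTopology I := ⟨rfl⟩
  choose l hfl hlf hl using hf.exists_lift
  have hch : ∀ {i : I} {c : Set Q}, IsChain (· ≤ ·) c → q ∈ c →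
      IsChain (· ≤ ·) (l i.1 '' c) := by
    rintro ⟨p, rfl⟩ c hc hqc _ ⟨a, ha, rfl⟩ _ ⟨b, hb, rfl⟩ -
    exact (hc.total ha hb).imp (hl p a b (hc.total hqc ha) (hc.total hqc hb))
      (hl p b a (hc.total hqc hb) (hc.total hqc ha))
  have hch' : ∀ (i : I) (u : OrderComplex Q), u ∈ openStar q →
      IsChain (· ≤ ·) (l i.1 '' (u.1.support : Set Q)) := fun i u hu =>
    hch u.2.2.1 (mem_openStar.1 hu)
  have hsec : ∀ (i : I) (u : OrderComplex Q) (hu : u ∈ openStar q),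
      hf.realize (map (l i.1) u (hch' i u hu)) = u := by
    rintro ⟨p, rfl⟩ u hu
    refine Subtype.ext ?_
    simp only [realize, map]
    rw [← Finsupp.mapDomain_comp, Finsupp.mapDomain_congr (g := id), Finsupp.mapDomain_id]
    intro a ha
    exact hfl p a (u.comparable (mem_openStar.1 hu) ha)
  have hret : ∀ (i : I) (w : OrderComplex P) (hw : hf.realize w ∈ openStar q), i.1 ∈ w.1.support →
      map (l i.1) (hf.realize w) (hch' i _ hw) = w := by
    rintro ⟨p, rfl⟩ w hw hp
    refine Subtype.ext ?_
    simp only [realize, map]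
    rw [← Finsupp.mapDomain_comp, Finsupp.mapDomain_congr (g := id), Finsupp.mapDomain_id]
    intro a ha
    exact hlf p a (w.comparable hp ha)
  choose pt hpt hfpt using fun w : hf.realize ⁻¹' openStar q => hf.exists_of_mem_openStar w.2
  have huniq : ∀ (w : hf.realize ⁻¹' openStar q) (i : I), i.1 ∈ w.1.1.support → pt w = i.1 :=
    fun w i hi => hf.eq_of_comparable (w.1.comparable (hpt w) hi) ((hfpt w).trans i.2.symm)
  have hcont : ∀ i : I, Continuous fun u : openStar q => map (l i.1) u.1 (hch' i u.1 u.2) := by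
    intro i
    refine continuous_def.2 fun V hV => ?_
    have : IsOpen {u : OrderComplex Q |
        ∃ hu : u ∈ openStar q, map (l i.1) u (hch' i u hu) ∈ V} := by
      refine isOpen_iff.2 fun c hc => ?_
      by_cases hqc : q ∈ c
      · have h1 : IsOpen {w : Simplex c | w.1 ∈ openStar q} := isOpen_iff.1 (isOpen_openStar q) c hc
        have h2 := hV.preimage (continuous_map (l i.1) (hch (i := i) hc hqc))
        convert h1.inter h2 using 1
        ext w
        exact ⟨fun ⟨h1, h2⟩ => ⟨h1, h2⟩, fun ⟨h1, h2⟩ => ⟨h1, h2⟩⟩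
      · convert isOpen_empty
        refine Set.eq_empty_of_forall_notMem fun w hw => ?_
        obtain ⟨hu, -⟩ := hw
        exact hqc (w.2 (mem_openStar.1 hu))
    convert this.preimage (continuous_subtype_val (p := fun u => u ∈ openStar q)) using 1
    exact Set.ext fun u => ⟨fun h => ⟨u.2, h⟩, fun ⟨_, h⟩ => h⟩
  refine IsEvenlyCovered.to_isEvenlyCovered_preimage (I := I) ⟨inferInstance, openStar q,
    mem_openStar.2 hq, isOpen_openStar q, (isOpen_openStar q).preimage hf.continuous_realize, ?_⟩
  refine ⟨⟨⟨fun w => (⟨hf.realize w.1, w.2⟩, ⟨pt w, hfpt w⟩),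
    fun u => ⟨map (l u.2.1) u.1.1 (hch' u.2 u.1.1 u.1.2), ?_⟩, ?_, ?_⟩, ?_, ?_⟩, fun _ => rfl⟩
  · rw [Set.mem_preimage, hsec u.2 u.1.1 u.1.2]; exact u.1.2
  · intro w
    exact Subtype.ext (hret ⟨pt w, hfpt w⟩ w.1 w.2 (hpt w))
  · rintro ⟨u, i⟩
    refine Prod.ext (Subtype.ext (hsec i u.1 u.2)) (Subtype.ext ?_)
    obtain ⟨a, ha, e⟩ := Finset.mem_image.1 (Finsupp.mapDomain_support
      (hpt ⟨map (l i.1) u.1 (hch' i u.1 u.2), by rw [Set.mem_preimage, hsec i u.1 u.2]; exact u.2⟩))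
    have h1 := hfpt ⟨map (l i.1) u.1 (hch' i u.1 u.2), by
      rw [Set.mem_preimage, hsec i u.1 u.2]; exact u.2⟩
    obtain ⟨p, rfl⟩ := i
    rw [← e, hfl p a (u.1.comparable (mem_openStar.1 u.2) ha)] at h1
    rw [h1, hlf p p (Or.inl le_rfl)] at e
    exact e.symm
  · refine Continuous.prodMk ((hf.continuous_realize.comp continuous_subtype_val).subtype_mk _) ?_
    refine continuous_discrete_rng.2 fun i => ?_
    convert (isOpen_openStar i.1).preimage
      (continuous_subtype_val (p := fun w => w ∈ hf.realize ⁻¹' openStar q)) using 1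
    ext w
    simp only [Set.mem_preimage, Set.mem_singleton_iff, mem_openStar]
    constructor
    · rintro rfl; exact hpt w
    · exact fun h => Subtype.ext (huniq w i h)
  · refine Continuous.subtype_mk (continuous_prod_of_discrete_right.2 hcont) _

end IsPosetCovering

end

section

/-! ### Coverings of simply connected spaces and of spheres -/

namespace IsCoveringMap

variable {E X : Type*} [TopologicalSpace E] [TopologicalSpace X] {p : E → X}

theorem eq_of_joined_of_simplyConnected (cov : IsCoveringMap p) [SimplyConnectedSpace X] {e e' : E}
    (h : Joined e e') (hp : p e = p e') : e = e' := by
  obtain ⟨γ⟩ := h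
  have h1 := SimplyConnectedSpace.paths_homotopic (γ.map cov.continuous)
    ((Path.refl (p e)).cast rfl hp.symm)
  have h2 := cov.liftPath_apply_one_eq_of_homotopicRel h1 e (by simp) (by simp)
  have h3 : γ.toContinuousMap = cov.liftPath (γ.map cov.continuous).toContinuousMap e (by simp) :=
    (cov.eq_liftPath_iff' _).2 ⟨rfl, γ.source⟩
  have h4 : ContinuousMap.const _ e =
      cov.liftPath ((Path.refl (p e)).cast rfl hp.symm).toContinuousMap e (by simp) :=
    (cov.eq_liftPath_iff' _).2 ⟨rfl, rfl⟩
  rw [← h3, ← h4] at h2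
  simpa using h2.symm

theorem eq_of_joined_of_section (cov : IsCoveringMap p) {s : X → E} (hs : Continuous s)
    (hps : ∀ x, p (s x) = x) {e e' : E} (hse : s (p e) = e) (h : Joined e e') (hp : p e = p e') :
    e = e' := by
  obtain ⟨γ⟩ := h
  have h1 : s ∘ p ∘ γ = γ := cov.eq_of_comp_eq (hs.comp (cov.continuous.comp γ.continuous))
    γ.continuous (funext fun t => hps _) 0 (by simpa using hse)
  have h2 := congrFun h1 1
  simp only [Function.comp_apply, γ.target] at h2
  rw [← hse, hp, h2]

variable {V : Type*} [NormedAddCommGroup V] [InnerProductSpace ℝ V]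

open Metric Module in
/-- A covering of a sphere has sections over the complement of a point. -/
theorem exists_section_sphere_compl {p : E → sphere (0 : V) 1} (cov : IsCoveringMap p)
    (v : sphere (0 : V) 1) {e : E} (he : p e ≠ v) :
    ∃ s : sphere (0 : V) 1 → E, ContinuousOn s {v}ᶜ ∧ (∀ x, x ≠ v → p (s x) = x) ∧
      s (p e) = e := by
  let φ := stereographic (norm_eq_of_mem_sphere v)
  have hsrc : φ.source = {v}ᶜ := stereographic_source _
  have hpe : p e ∈ φ.source := by rw [hsrc]; exact he
  obtain ⟨F, ⟨hF, hF'⟩, -⟩ := cov.existsUnique_continuousMap_lifts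
    ⟨φ.symm, (isOpenEmbedding_stereographic_symm _).continuous⟩ (φ (p e)) e (φ.left_inv hpe).symm
  refine ⟨fun x => F (φ x), F.continuous.comp_continuousOn (hsrc ▸ φ.continuousOn), fun x hx => ?_,
    hF⟩
  have hx' : x ∈ φ.source := by rw [hsrc]; exact hx
  exact (congrFun hF' (φ x)).trans (φ.left_inv hx')

open Metric Module in
theorem isPreconnected_sphere_compl_pair [FiniteDimensional ℝ V] (hV : 2 < finrank ℝ V)
    (v : sphere (0 : V) 1) :
    IsPreconnected ({v, -v}ᶜ : Set (sphere (0 : V) 1)) := by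
  let φ := stereographic (norm_eq_of_mem_sphere v)
  have hsrc : φ.source = {v}ᶜ := stereographic_source _
  have hv : -v ≠ v := (ne_neg_of_mem_unit_sphere ℝ v).symm
  have : ({v, -v}ᶜ : Set (sphere (0 : V) 1)) = φ.symm '' {0}ᶜ := by
    have h0 : φ.symm 0 = -v := by
      have h1 : φ (-v) = 0 := stereographic_apply_neg v
      rw [← h1]; exact φ.left_inv (by rw [hsrc]; exact hv)
    have hinj : Function.Injective φ.symm := (isOpenEmbedding_stereographic_symm _).injective
    have hr : Set.range φ.symm = {v}ᶜ := range_stereographic_symm (norm_eq_of_mem_sphere v) v.2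
    rw [Set.image_compl_eq_range_sdiff_image hinj, hr, Set.image_singleton, h0]
    ext x
    simp [not_or]
  rw [this]
  refine (isConnected_compl_singleton_of_one_lt_rank ?_ 0).isPreconnected.image _
    (isOpenEmbedding_stereographic_symm _).continuous.continuousOn
  have h1 := Submodule.finrank_add_finrank_orthogonal (ℝ ∙ v.1)
  rw [finrank_span_singleton (ne_zero_of_mem_unit_sphere v)] at h1
  rw [← finrank_eq_rank]
  exact_mod_cast (by omega : 1 < finrank ℝ (ℝ ∙ v.1)ᗮ)

open Metric Module in
/-- A covering of a sphere of dimension at least two is injective on path components: the sections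
over the complements of two antipodal points agree on the intersection, which is connected, and
define a global section. -/
theorem eq_of_joined_of_sphere [FiniteDimensional ℝ V] (hV : 2 < finrank ℝ V)
    {p : E → sphere (0 : V) 1} (cov : IsCoveringMap p) {e e' : E} (h : Joined e e')
    (hp : p e = p e') : e = e' := by
  obtain ⟨v, hv, hv'⟩ : ∃ v : sphere (0 : V) 1, p e ≠ v ∧ p e ≠ -v := by
    by_contra! hcon
    obtain ⟨u, hu, hu0⟩ : ∃ u ∈ (ℝ ∙ (p e).1)ᗮ, u ≠ 0 := by
      refine Submodule.exists_mem_ne_zero_of_ne_bot fun h0 => ?_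
      have h1 := Submodule.finrank_add_finrank_orthogonal (ℝ ∙ (p e).1)
      rw [h0, finrank_bot] at h1
      rw [finrank_span_singleton (ne_zero_of_mem_unit_sphere (p e))] at h1
      omega
    have hin := Submodule.mem_orthogonal_singleton_iff_inner_right.1 hu
    let w : sphere (0 : V) 1 := ⟨‖u‖⁻¹ • u, by simp [norm_smul, hu0]⟩
    have h1 : ∀ c : ℝ, (p e).1 ≠ c • u := fun c hc => by
      have h2 : inner ℝ (p e).1 (p e).1 = 0 := by
        conv_lhs => rw [hc, inner_smul_right, ← hc, hin, mul_zero]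
      exact ne_zero_of_mem_unit_sphere (p e) (inner_self_eq_zero.1 h2)
    have h2 : p e ≠ w := fun h => h1 _ (congrArg Subtype.val h)
    exact h1 (-‖u‖⁻¹) (by rw [hcon w h2]; simp [w])
  obtain ⟨s, hs, hps, hse⟩ := cov.exists_section_sphere_compl v hv
  obtain ⟨s', hs', hps', hse'⟩ := cov.exists_section_sphere_compl (-v) hv'
  have hsub : ({v, -v}ᶜ : Set (sphere (0 : V) 1)) ⊆ {v}ᶜ ∩ {-v}ᶜ := fun x hx =>
    ⟨fun h => hx (Or.inl h), fun h => hx (Or.inr h)⟩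
  have heq : ({v, -v}ᶜ : Set (sphere (0 : V) 1)).EqOn s s' :=
    cov.eqOn_of_comp_eqOn (isPreconnected_sphere_compl_pair hV v)
      (hs.mono (hsub.trans Set.inter_subset_left)) (hs'.mono (hsub.trans Set.inter_subset_right))
      (fun x hx => (hps x (hsub hx).1).trans (hps' x (hsub hx).2).symm)
      (a := p e) (by simp [hv, hv']) (hse.trans hse'.symm)
  classical
  let S : sphere (0 : V) 1 → E := fun x => if x = v then s' x else s x
  have hS : ({v}ᶜ : Set (sphere (0 : V) 1)).EqOn S s := fun x hx => if_neg hx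
  have hS' : ({-v}ᶜ : Set (sphere (0 : V) 1)).EqOn S s' := fun x hx => by
    by_cases hxv : x = v
    · exact if_pos hxv
    · exact (if_neg hxv).trans (heq fun h => h.elim hxv hx)
  have hvv : v ≠ -v := ne_neg_of_mem_unit_sphere ℝ v
  refine cov.eq_of_joined_of_section (s := S) ?_ (fun x => ?_) ((hS hv).trans hse) h hp
  · refine continuous_iff_continuousAt.2 fun x => ?_
    by_cases hxv : x = v
    · have hx : x ∈ ({-v}ᶜ : Set (sphere (0 : V) 1)) := by rw [hxv]; exact hvv
      exact (hs'.congr hS').continuousAt (isOpen_compl_singleton.mem_nhds hx)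
    · exact (hs.congr hS).continuousAt (isOpen_compl_singleton.mem_nhds hxv)
  · by_cases hxv : x = v
    · rw [hS' (by rw [hxv]; exact hvv)]
      exact hps' x (by rw [hxv]; exact hvv)
    · rw [hS hxv]; exact hps x hxv

end IsCoveringMap

end

section

variable {n : ℕ}

/-! ### The cubical lattice and its symmetries in Euclidean space -/

/-- The face of the cubical lattice with the given coordinates, as a set of points. -/
def cellSet (c : Fin n → Cell) : Set (Fin n → ℝ) :=
  Set.Icc (fun i => (((c i).z / 2 : ℤ) : ℝ)) (fun i => ((((c i).z + 1) / 2 : ℤ) : ℝ))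

theorem cellSet_subset_iff {c d : Fin n → Cell} : cellSet c ⊆ cellSet d ↔ c ≤ d := by
  rw [cellSet, cellSet, Set.Icc_subset_Icc_iff (fun i => by
    simp only [Int.cast_le]; omega), Pi.le_def, Pi.le_def, Pi.le_def, ← forall_and]
  refine forall_congr' fun i => ?_
  simp only [Int.cast_le, Cell.le_iff]
  omega

/-- The coordinates identify the faces of the cubical lattice with `Fin n → Cell`. -/
noncomputable def cellEquiv (n : ℕ) : (Fin n → Cell) ≃o ZFace n :=
  OrderIso.ofSurjective (OrderEmbedding.ofMapLEIff
    (fun c => (⟨cellSet c, _, _, fun i => by omega, rfl⟩ : ZFace n))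
    fun _ _ => cellSet_subset_iff) (by
  rintro ⟨_, a, b, hab, rfl⟩
  refine ⟨fun i => ⟨a i + b i⟩, Subtype.ext ?_⟩
  have h1 : ∀ i, (a i + b i) / 2 = a i := fun i => by have := hab i; omega
  have h2 : ∀ i, (a i + b i + 1) / 2 = b i := fun i => by have := hab i; omega
  simp [cellSet, h1, h2])

theorem cellEquiv_val (c : Fin n → Cell) : (cellEquiv n c).1 = cellSet c := rfl

/-- The symmetry `x ↦ (ε i * x (σ i) + t i)` of the cubical lattice, acting on points. -/
def pointSymm (σ : Equiv.Perm (Fin n)) (ε : Fin n → ℤˣ) (t : Fin n → ℤ) :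
    Equiv.Perm (Fin n → ℝ) where
  toFun x i := ((ε i : ℤ) : ℝ) * x (σ i) + (t i : ℝ)
  invFun y i := ((ε (σ.symm i) : ℤ) : ℝ) * (y (σ.symm i) - (t (σ.symm i) : ℝ))
  left_inv x := by
    funext i
    rcases Int.units_eq_one_or (ε (σ.symm i)) with e | e <;> simp [e]
  right_inv x := by
    funext i
    rcases Int.units_eq_one_or (ε i) with e | e <;> simp [e]

theorem pointSymm_apply (σ : Equiv.Perm (Fin n)) (ε : Fin n → ℤˣ) (t : Fin n → ℤ) (x : Fin n → ℝ)
    (i : Fin n) : pointSymm σ ε t x i = ((ε i : ℤ) : ℝ) * x (σ i) + (t i : ℝ) := rfl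

theorem mem_latticeSymmetryGroup {g : Equiv.Perm (Fin n → ℝ)} :
    g ∈ latticeSymmetryGroup n ↔ ∃ σ ε t, g = pointSymm σ ε t := by
  constructor
  · rintro ⟨σ, ε, t, h⟩
    exact ⟨σ, ε, t, Equiv.ext fun x => funext fun i => h x i⟩
  · rintro ⟨σ, ε, t, rfl⟩
    exact ⟨σ, ε, t, fun _ _ => rfl⟩

theorem pointSymm_mem_cellSet {σ : Equiv.Perm (Fin n)} {ε : Fin n → ℤˣ} {t : Fin n → ℤ}
    {x : Fin n → ℝ} {c : Fin n → Cell} :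
    pointSymm σ ε t x ∈ cellSet (cellSymm σ ε t c) ↔ x ∈ cellSet c := by
  simp only [cellSet, Set.mem_Icc, Pi.le_def, ← forall_and]
  rw [← σ.forall_congr_right (q := fun i => _ ≤ x i ∧ x i ≤ _)]
  refine forall_congr' fun i => ?_
  simp only [pointSymm_apply, cellSymm]
  generalize (c (σ i)).z = z
  rcases Int.units_eq_one_or (ε i) with e | e
  · have h1 : ((ε i : ℤ) * z + 2 * t i) / 2 = z / 2 + t i := by rw [e]; push_cast; omega
    have h2 : ((ε i : ℤ) * z + 2 * t i + 1) / 2 = (z + 1) / 2 + t i := by rw [e]; push_cast; omega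
    rw [h1, h2, e]
    push_cast
    constructor <;> rintro ⟨h, h'⟩ <;> constructor <;> linarith
  · have h1 : ((ε i : ℤ) * z + 2 * t i) / 2 = -((z + 1) / 2) + t i := by rw [e]; push_cast; omega
    have h2 : ((ε i : ℤ) * z + 2 * t i + 1) / 2 = -(z / 2) + t i := by rw [e]; push_cast; omega
    rw [h1, h2, e]
    push_cast
    constructor <;> rintro ⟨h, h'⟩ <;> constructor <;> linarith

theorem pointSymm_image (σ : Equiv.Perm (Fin n)) (ε : Fin n → ℤˣ) (t : Fin n → ℤ)
    (c : Fin n → Cell) : pointSymm σ ε t '' cellSet c = cellSet (cellSymm σ ε t c) := by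
  ext y
  obtain ⟨x, rfl⟩ := (pointSymm σ ε t).surjective y
  rw [(pointSymm σ ε t).injective.mem_set_image, pointSymm_mem_cellSet]

/-- The smallest face that contains a fixed point of a symmetry is mapped to itself. -/
theorem exists_fixed_cell {σ : Equiv.Perm (Fin n)} {ε : Fin n → ℤˣ} {t : Fin n → ℤ}
    {x : Fin n → ℝ} (h : pointSymm σ ε t x = x) : ∃ c, cellSymm σ ε t c = c := by
  refine ⟨fun i => ⟨⌊x i⌋ + ⌈x i⌉⟩, ?_⟩
  funext i
  ext
  simp only [cellSymm]
  have hi := congrFun h i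
  rw [pointSymm_apply] at hi
  rw [← hi]
  rcases Int.units_eq_one_or (ε i) with e | e <;> rw [e] <;> push_cast
  · rw [one_mul, one_mul, Int.floor_add_intCast, Int.ceil_add_intCast]; ring
  · rw [neg_one_mul, neg_one_mul, Int.floor_add_intCast, Int.ceil_add_intCast, Int.floor_neg,
      Int.ceil_neg]; ring

/-- A symmetry of finite order has a fixed point: the barycentre of an orbit. -/
theorem exists_fixed_point {σ : Equiv.Perm (Fin n)} {ε : Fin n → ℤˣ} {t : Fin n → ℤ}
    (h : IsOfFinOrder (pointSymm σ ε t)) : ∃ x, pointSymm σ ε t x = x := by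
  obtain ⟨k, hk, hg⟩ := isOfFinOrder_iff_pow_eq_one.1 h
  set g := pointSymm σ ε t with hgdef
  have hk' : (k : ℝ) ≠ 0 := by exact_mod_cast hk.ne'
  refine ⟨fun i => (∑ j ∈ Finset.range k, (g ^ j) 0 i) / k, ?_⟩
  funext i
  have h1 : ∑ j ∈ Finset.range k, (g ^ (j + 1)) 0 i = ∑ j ∈ Finset.range k, (g ^ j) 0 i := by
    have h2 := Finset.sum_range_succ (fun j => (g ^ j) 0 i) k
    rw [Finset.sum_range_succ', hg] at h2
    simpa using h2
  have h3 : ∀ j, (g ^ (j + 1)) 0 i = ((ε i : ℤ) : ℝ) * (g ^ j) 0 (σ i) + t i := fun j => by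
    rw [pow_succ', Equiv.Perm.mul_apply]; rfl
  rw [← h1]
  simp only [h3, Finset.sum_add_distrib, ← Finset.mul_sum, Finset.sum_const, Finset.card_range,
    nsmul_eq_mul]
  rw [hgdef, pointSymm_apply]
  field_simp

/-! ### The group of symmetries of the developing map -/

variable {L : Type*} {p : (Fin n → Cell) → L}

/-- The symmetries of the cubical lattice that preserve a map on its faces. The action on faces is
expressed by images of sets of points. -/
def symmetriesOf (p : (Fin n → Cell) → L) : Subgroup (Equiv.Perm (Fin n → ℝ)) where
  carrier := {g | g ∈ latticeSymmetryGroup n ∧ ∀ c d, g '' cellSet c = cellSet d → p c = p d}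
  one_mem' := ⟨one_mem _, fun c d h => by
    have h' : cellSet c = cellSet d := by simpa using h
    rw [le_antisymm (cellSet_subset_iff.1 h'.le) (cellSet_subset_iff.1 h'.ge)]⟩
  mul_mem' := by
    rintro g h ⟨hg, hg'⟩ ⟨hh, hh'⟩
    refine ⟨mul_mem hg hh, fun c d hcd => ?_⟩
    obtain ⟨σ, ε, t, rfl⟩ := mem_latticeSymmetryGroup.1 hh
    have e := pointSymm_image σ ε t c
    refine (hh' c _ e).trans (hg' _ d ?_)
    rw [← e, ← hcd, ← Set.image_comp]
    rfl
  inv_mem' := by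
    rintro g ⟨hg, hg'⟩
    refine ⟨inv_mem hg, fun c d hcd => (hg' d c ?_).symm⟩
    rw [← hcd, ← Set.image_comp]
    ext x
    simp

theorem pointSymm_mem_symmetriesOf {σ : Equiv.Perm (Fin n)} {ε : Fin n → ℤˣ} {t : Fin n → ℤ} :
    pointSymm σ ε t ∈ symmetriesOf p ↔ p ∘ cellSymm σ ε t = p := by
  constructor
  · rintro ⟨-, h⟩
    funext c
    exact (h c _ (pointSymm_image σ ε t c)).symm
  · intro h
    refine ⟨mem_latticeSymmetryGroup.2 ⟨σ, ε, t, rfl⟩, fun c d hcd => ?_⟩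
    rw [pointSymm_image] at hcd
    rw [← le_antisymm (cellSet_subset_iff.1 hcd.le) (cellSet_subset_iff.1 hcd.ge)]
    exact (congrFun h c).symm

variable [Lattice L] [BoundedOrder L]

namespace IsDeveloping

theorem eq_one_of_fixed_point (hp : IsDeveloping p) (hL : IsFlat n L)
    {g : Equiv.Perm (Fin n → ℝ)} (hg : g ∈ symmetriesOf p) {x : Fin n → ℝ} (hx : g x = x) :
    g = 1 := by
  obtain ⟨σ, ε, t, rfl⟩ := mem_latticeSymmetryGroup.1 hg.1
  obtain ⟨c, hc⟩ := exists_fixed_cell hx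
  have h := hp.cellSymm_eq_one hL (pointSymm_mem_symmetriesOf.1 hg) hc
  refine Equiv.ext fun y => funext fun i => ?_
  rw [pointSymm_apply, (h i).1, (h i).2.1, (h i).2.2]
  simp

/-- The faces of the complex are the orbits of the symmetries of the developing map. -/
theorem nonempty_orderIso_quotient (hp : IsDeveloping p) (hL : IsFlat n L) (hn : 0 < n)
    (hK : IsClosedCubicalComplex n L) : Nonempty (ProperFace L ≃o ZQuotient (symmetriesOf p)) := by
  have hcov := hp.isPosetCovering hL hn hK
  let e := (cellEquiv n).symm
  have he : ∀ F, cellSet (e F) = F.1 := fun F => by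
    rw [← cellEquiv_val, OrderIso.apply_symm_apply]
  let ψ : ZQuotient (symmetriesOf p) → ProperFace L :=
    Quotient.lift (fun F => hp.toProperFace (e F)) (by
      rintro F G ⟨g, hg, h⟩
      rw [← he, ← he] at h
      exact Subtype.ext (hg.2 _ _ h))
  have hψ : ∀ F, ψ (Quotient.mk (orbitSetoid (symmetriesOf p)) F) = hp.toProperFace (e F) :=
    fun _ => rfl
  have hinj : Function.Injective ψ := by
    intro a b
    induction a using Quotient.inductionOn with | _ F
    induction b using Quotient.inductionOn with | _ G
    intro h
    obtain ⟨σ, ε, t, h1, h2⟩ := hp.exists_cellSymm hL hn hK (congrArg Subtype.val h)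
    refine Quotient.sound ⟨pointSymm σ ε t, pointSymm_mem_symmetriesOf.2 h1, ?_⟩
    rw [← he, pointSymm_image, h2, he]
  have hsurj : Function.Surjective ψ := by
    intro y
    obtain ⟨d, hd⟩ := hp.surjective hL hn hK y.2.1 y.2.2
    refine ⟨Quotient.mk _ (cellEquiv n d), ?_⟩
    rw [hψ]
    rw [OrderIso.symm_apply_apply]
    exact Subtype.ext hd
  refine ⟨OrderIso.symm ⟨Equiv.ofBijective ψ ⟨hinj, hsurj⟩, ?_⟩⟩
  intro a b
  change ψ a ≤ ψ b ↔ a ≤ b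
  constructor
  · intro h
    obtain ⟨F, rfl⟩ := Quotient.exists_rep a
    obtain ⟨d, hd, hd'⟩ := hcov.exists_ge (e F) (ψ b) h
    refine ⟨F, cellEquiv n d, rfl, hinj ?_, ?_⟩
    · rw [hψ, ← hd']
      simp [e]
    · rw [← (cellEquiv n).apply_symm_apply F]
      exact (cellEquiv n).monotone hd
  · rintro ⟨F, G, rfl, rfl, h⟩
    exact hcov.mono (e.monotone h)

end IsDeveloping

/-- The order complex of the faces of the cubical lattice is connected. -/
theorem joined_point_cell (c d : Fin n → Cell) :
    Joined (OrderComplex.point c) (OrderComplex.point d) := by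
  have key := Int.pi_induction (P := fun k => Joined (OrderComplex.point c)
    (OrderComplex.point fun i => (⟨k i⟩ : Cell))) (fun i => (c i).z) (Joined.refl _) (fun k i => ?_)
  · exact key fun i => (d i).z
  · have h : Joined (OrderComplex.point fun j => (⟨k j⟩ : Cell))
        (OrderComplex.point fun j => (⟨Function.update k i (k i + 1) j⟩ : Cell)) := by
      -- one of the two neighbouring integers is odd
      rcases Int.emod_two_eq_zero_or_one (k i) with e | e
      · refine OrderComplex.joined_point fun j => ?_
        by_cases hj : j = i
        · subst hj
          refine Cell.le_iff.2 (Or.inr ?_)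
          simp only [Function.update_self]
          omega
        · simp [hj]
      · refine (OrderComplex.joined_point fun j => ?_).symm
        by_cases hj : j = i
        · subst hj
          refine Cell.le_iff.2 (Or.inr ?_)
          simp [e]
        · simp [hj]
    exact ⟨fun h' => h'.trans h, fun h' => h'.trans h.symm⟩

end

theorem proposition3p1 (n : ℕ) (hn : 2 ≤ n) (L : Type*) [Lattice L] [BoundedOrder L]
    (hL : IsClosedCubicalComplex n L)
    (h4 : ∀ x : L, IsCubeFace (n - 2) x → {F : L | IsCoatom F ∧ x ≤ F}.ncard = 4) :
    IsEmpty (Realization L ≃ₜ Metric.sphere (0 : EuclideanSpace ℝ (Fin (n + 1))) 1) ∧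
    (SimplyConnectedSpace (Realization L) → Nonempty (ProperFace L ≃o ZFace n)) ∧
    (¬ SimplyConnectedSpace (Realization L) →
      ∃ Γ : Subgroup (Equiv.Perm (Fin n → ℝ)), Γ ≤ latticeSymmetryGroup n ∧
        (∀ g ∈ Γ, g ≠ 1 → ¬ IsOfFinOrder g) ∧
        (∀ g ∈ Γ, g ≠ 1 → ∀ x : Fin n → ℝ, g x ≠ x) ∧
        Nonempty (ProperFace L ≃o ZQuotient Γ)) := by
  have hn0 : 0 < n := by omega
  have hflat := isFlat_of_four hn hL h4
  obtain ⟨F, hF, -⟩ := hL.exists_facet ⊥ hL.bot_ne_top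
  obtain ⟨φ, hφ, -⟩ := hflat.exists_frame F hF
  obtain ⟨p, hp⟩ := hflat.exists_developing hφ
  have hcov := hp.isPosetCovering hflat hn0 hL
  have hsurj : Function.Surjective hp.toProperFace := fun y => by
    obtain ⟨d, hd⟩ := hp.surjective hflat hn0 hL y.2.1 y.2.2
    exact ⟨d, Subtype.ext hd⟩
  refine ⟨⟨fun h => ?_⟩, fun hsc => ?_, fun _ => ?_⟩
  · have hinj : Function.Injective hp.toProperFace := by
      intro c d hcd
      have h1 := IsCoveringMap.eq_of_joined_of_sphere (by simpa using hn)
        (hcov.isCoveringMap.homeomorph_comp h) (joined_point_cell c d) (by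
          simp [hcov.realize_point, hcd])
      exact OrderComplex.point_injective h1
    have : CompactSpace (Realization L) := h.symm.compactSpace
    have hfin : Finite (ProperFace L) := OrderComplex.finite_of_compactSpace
    have : Infinite (Fin n → Cell) := Infinite.of_injective (fun (z : ℤ) _ => (⟨z⟩ : Cell))
      fun a b hab => congrArg Cell.z (congrFun hab ⟨0, hn0⟩)
    exact not_finite_iff_infinite.2 this (Finite.of_injective _ hinj)
  · have hinj : Function.Injective hp.toProperFace := by
      intro c d hcd
      have h1 := hcov.isCoveringMap.eq_of_joined_of_simplyConnected (joined_point_cell c d) (by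
          simp [hcov.realize_point, hcd])
      exact OrderComplex.point_injective h1
    let e : (Fin n → Cell) ≃o ProperFace L :=
      ⟨Equiv.ofBijective _ ⟨hinj, hsurj⟩, fun {c d} =>
        ⟨fun h => by
          obtain ⟨d', hd', e⟩ := hcov.exists_ge c _ h
          exact hinj e ▸ hd', fun h => hcov.mono h⟩⟩
    exact ⟨e.symm.trans (cellEquiv n)⟩
  · refine ⟨symmetriesOf p, fun g hg => hg.1, fun g hg hg1 hfin => ?_, fun g hg hg1 x hx => ?_,
      hp.nonempty_orderIso_quotient hflat hn0 hL⟩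
    · obtain ⟨σ, ε, t, rfl⟩ := mem_latticeSymmetryGroup.1 hg.1
      obtain ⟨x, hx⟩ := exists_fixed_point hfin
      exact hg1 (hp.eq_one_of_fixed_point hflat hg hx)
    · exact hg1 (hp.eq_one_of_fixed_point hflat hg hx)
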